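/- Let $K=(S^1)^n$ be a compact torus with Lie algebra $\mathfrak k$, and let $G=(\mathbb C^*)^n\supset K$ be its complexification. Let $X$ be a (Hausdorff, second countable) complex manifold with complex structure $J$, on which $G$ acts properly, such that the orbit space $X/G$ exists as a (Hausdorff, second countable) complex manifold and $X\to X/G$ is an analytic locally trivial principal $G$-bundle; that is, the map $X\to X/G$ is $G$-invariant and $X/G$ has an open cover by sets $U$ over which there are $G$-equivariant biholomorphic maps from the preimage of $U$ to $G\times U$ over $U$. For $\xi\in\mathfrak k$ let $\xi_X$ be the vector field $\xi_X(x)=\frac{d}{dt}\big|_{t=0}\exp(t\xi)\cdot x$. A $K$-invariant smooth real two-form $\omega$ on a $K$-invariant open set $V\subseteq X$ is called momentumly closed if $d(\iota_{\xi_X}\omega)=0$ for all $\xi\in\mathfrak k$. A generalized moment map for it is a smooth $K$-invariant map $\Psi:V\to\mathfrak k^*$ with $d\langle\Psi,\xi\rangle=\iota_{\xi_X}\omega$ for all $\xi\in\mathfrak k$. The form $\omega$ is called Hermitian if $\omega(J\cdot,J\cdot)=\omega$ and $\omega(\cdot,J\cdot)$ is a Riemannian metric; it is called Kähler if it is moreover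 closed. If $\omega$ is Hermitian, $0$ is a regular value of $\Psi$ and $K$ acts freely on $\Psi^{-1}(0)$, then the reduction space of $\Psi$ at $0$ is the orbit space $\Psi^{-1}(0)/K$ with the smooth structure for which the projection $\pi:\Psi^{-1}(0)\to\Psi^{-1}(0)/K$ is a submersion, with the complex structure for which $d\pi$ is complex linear on $T\Psi^{-1}(0)\cap J\,T\Psi^{-1}(0)$, and with the Hermitian form $\omega_0$ determined by $\pi^*\omega_0=\omega|_{\Psi^{-1}(0)}$. Then there exist a $K$-invariant open subset $V$ of $X$, a non-degenerate momentumly closed Hermitian two-form $\omega$ on $V$ and a generalized moment map $\Psi:V\to\mathfrak k^*$ for $\omega$ such that $0$ is a regular value of $\Psi$, $K$ acts freely on $\Psi^{-1}(0)$, and the reduction space of $\Psi$ at $0$ is biholomorphic to $X/G$. Moreover, if $X/G$ is a Kähler manifold, then $V$, $\omega$ and $\Psi$ can be chosen such that in addition $\omega$ is a Kähler form on $V$. -/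

import Mathlib

open scoped Manifold ContDiff Topology

noncomputable section

namespace MomentReduction

/-! ### Compact tori and their complexifications -/

/-- The compact torus `K = (S¹)ⁿ`.  Its Lie algebra `𝔨` is identified with `ℝⁿ` by means of the
exponential map `CompactTorus.exp`. -/
abbrev CompactTorus (n : ℕ) : Type := Fin n → Circle

/-- The complexification `G = (ℂˣ)ⁿ` of the compact torus `K = (S¹)ⁿ`. -/
abbrev ComplexTorus (n : ℕ) : Type := Fin n → ℂˣ

/-- The inclusion `K ⊆ G`. -/
def CompactTorus.incl (n : ℕ) : CompactTorus n →* ComplexTorus n :=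
  Circle.toUnits.compLeft (Fin n)

/-- The exponential map `𝔨 = ℝⁿ → K`, `ξ ↦ (exp (i ξ₁), …, exp (i ξₙ))`. -/
def CompactTorus.exp {n : ℕ} (ξ : Fin n → ℝ) : CompactTorus n := fun j => Circle.exp (ξ j)

/-! ### Differential forms on complex manifolds

A complex manifold is modelled on a finite-dimensional complex vector space `E`; its underlying
smooth manifold is modelled on `E` as a real vector space, with the same charts.  As everywhere in
Mathlib, the tangent space at `x` is `E`, identified through the preferred chart at `x`. -/

section Forms

variable {E : Type*} [NormedAddCommGroup E] [NormedSpace ℂ E]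
  {X : Type*} [TopologicalSpace X] [ChartedSpace E X]

/-- A (not necessarily smooth) real differential `k`-form on `X`: an alternating `k`-linear form on
each (real) tangent space. -/
abbrev DiffForm (E : Type*) [NormedAddCommGroup E] [NormedSpace ℂ E] (X : Type*)
    [TopologicalSpace X] [ChartedSpace E X] (k : ℕ) : Type _ :=
  (x : X) → E [⋀^Fin k]→L[ℝ] ℝ

/-- The pullback of a form to the model space under the inverse of the preferred chart at `x₀`. -/
def DiffForm.inChart {k : ℕ} (α : DiffForm E X k) (x₀ : X) : E → E [⋀^Fin k]→L[ℝ] ℝ := fun e =>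
  (α ((extChartAt 𝓘(ℝ, E) x₀).symm e)).compContinuousLinearMap
    (mfderiv 𝓘(ℝ, E) 𝓘(ℝ, E) (extChartAt 𝓘(ℝ, E) x₀).symm e)

/-- The form `α` is smooth (`C^∞`) on the open set `V`: its coefficients in the charts are. -/
def DiffForm.SmoothOn {k : ℕ} (α : DiffForm E X k) (V : Set X) : Prop :=
  ∀ x₀ : X, ContDiffOn ℝ ∞ (α.inChart x₀)
    ((extChartAt 𝓘(ℝ, E) x₀).target ∩ (extChartAt 𝓘(ℝ, E) x₀).symm ⁻¹' V)

/-- The exterior derivative `dα` of a form: at `x` it is the exterior derivative of the expression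
of `α` in the preferred chart at `x` (in which the tangent space at `x` is `E`). -/
def DiffForm.d {k : ℕ} (α : DiffForm E X k) : DiffForm E X (k + 1) := fun x =>
  extDeriv (α.inChart x) (extChartAt 𝓘(ℝ, E) x x)

/-- The form `α` is closed on the open set `V`. -/
def DiffForm.ClosedOn {k : ℕ} (α : DiffForm E X k) (V : Set X) : Prop :=
  ∀ x ∈ V, α.d x = 0

/-- The contraction `ι_Z α` of a form with a vector field `Z`, inserted in the first slot. -/
def DiffForm.contract {k : ℕ} (Z : X → E) (α : DiffForm E X (k + 1)) : DiffForm E X k := fun x =>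
  (α x).curryLeft (Z x)

/-- A two-form is non-degenerate on `V`. -/
def DiffForm.NondegenerateOn (Ω : DiffForm E X 2) (V : Set X) : Prop :=
  ∀ x ∈ V, ∀ v : E, (∀ u : E, Ω x ![v, u] = 0) → v = 0

/-- A two-form `Ω` is Hermitian on `V` (the fundamental form of a Hermitian metric): it is
invariant under the complex structure `J`, which is multiplication by `i` on tangent vectors, and
`Ω (·, J ·)` is positive definite. -/
def DiffForm.HermitianOn (Ω : DiffForm E X 2) (V : Set X) : Prop :=
  ∀ x ∈ V, (∀ v u : E, Ω x ![Complex.I • v, Complex.I • u] = Ω x ![v, u]) ∧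
    ∀ v : E, v ≠ 0 → 0 < Ω x ![v, Complex.I • v]

/-- A smooth two-form is a Kähler form on the open set `V`: it is Hermitian and closed. -/
structure DiffForm.KahlerOn (Ω : DiffForm E X 2) (V : Set X) : Prop where
  smooth : Ω.SmoothOn V
  hermitian : Ω.HermitianOn V
  closed : Ω.ClosedOn V

end Forms

/-- The complex manifold `Y` is a Kähler manifold: it carries a Kähler form. -/
def IsKahlerManifold (F : Type*) [NormedAddCommGroup F] [NormedSpace ℂ F] (Y : Type*)
    [TopologicalSpace Y] [ChartedSpace F Y] : Prop :=
  ∃ σ : DiffForm F Y 2, σ.KahlerOn Set.univ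

/-! ### Torus actions, momentumly closed forms and generalized moment maps -/

section Actions

variable {n : ℕ} {E : Type*} [NormedAddCommGroup E] [NormedSpace ℂ E]
  {X : Type*} [TopologicalSpace X] [ChartedSpace E X] [MulAction (ComplexTorus n) X]

/-- The vector field `ξ_X` on `X` generated by `ξ ∈ 𝔨`: its value at `x` is the derivative of
`t ↦ exp (t ξ) • x` at `t = 0`. -/
def fundamentalField (E : Type*) [NormedAddCommGroup E] [NormedSpace ℂ E] {X : Type*}
    [TopologicalSpace X] [ChartedSpace E X] [MulAction (ComplexTorus n) X]
    (ξ : Fin n → ℝ) : X → E := fun x =>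
  mfderiv 𝓘(ℝ, ℝ) 𝓘(ℝ, E)
    (fun t : ℝ => CompactTorus.incl n (CompactTorus.exp (t • ξ)) • x) 0 (1 : ℝ)

/-- The set `V` is `K`-invariant. -/
def KInvariantSet (n : ℕ) {X : Type*} [MulAction (ComplexTorus n) X] (V : Set X) : Prop :=
  ∀ (k : CompactTorus n), ∀ x ∈ V, CompactTorus.incl n k • x ∈ V

/-- The two-form `Ω` is `K`-invariant on the `K`-invariant set `V`: one has `k^* Ω = Ω` on `V`. -/
def KInvariantFormOn (n : ℕ) {E : Type*} [NormedAddCommGroup E] [NormedSpace ℂ E] {X : Type*}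
    [TopologicalSpace X] [ChartedSpace E X] [MulAction (ComplexTorus n) X]
    (Ω : DiffForm E X 2) (V : Set X) : Prop :=
  ∀ (k : CompactTorus n), ∀ x ∈ V,
    (Ω (CompactTorus.incl n k • x)).compContinuousLinearMap
      (mfderiv 𝓘(ℝ, E) 𝓘(ℝ, E) (fun y : X => CompactTorus.incl n k • y) x) = Ω x

/-- A two-form is momentumly closed on the `K`-invariant open set `V`: it is `K`-invariant, and the
contraction `ι_{ξ_X} Ω` is closed for every `ξ ∈ 𝔨`. -/
structure MomentumlyClosedOn (n : ℕ) {E : Type*} [NormedAddCommGroup E] [NormedSpace ℂ E]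
    {X : Type*} [TopologicalSpace X] [ChartedSpace E X] [MulAction (ComplexTorus n) X]
    (Ω : DiffForm E X 2) (V : Set X) : Prop where
  invariant : KInvariantFormOn n Ω V
  closed : ∀ ξ : Fin n → ℝ, (DiffForm.contract (fundamentalField E ξ) Ω).ClosedOn V

/-- `Ψ : V → 𝔨^*` is a generalized moment map for the two-form `Ω` on the `K`-invariant open set
`V`: it is smooth, it is `K`-equivariant (the coadjoint action of the abelian group `K` being
trivial), and `dΨ^ξ = ι_{ξ_X} Ω` for all `ξ ∈ 𝔨`, where `Ψ^ξ = ⟨Ψ, ξ⟩`. -/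
structure IsGeneralizedMomentMapOn (Ω : DiffForm E X 2) (Ψ : X → StrongDual ℝ (Fin n → ℝ))
    (V : Set X) : Prop where
  smooth : ContMDiffOn 𝓘(ℝ, E) 𝓘(ℝ, StrongDual ℝ (Fin n → ℝ)) ∞ Ψ V
  equivariant : ∀ (k : CompactTorus n), ∀ x ∈ V, Ψ (CompactTorus.incl n k • x) = Ψ x
  deriv_eq : ∀ ξ : Fin n → ℝ, ∀ x ∈ V, ∀ v : E,
    mfderiv 𝓘(ℝ, E) 𝓘(ℝ, ℝ) (fun y : X => Ψ y ξ) x v = Ω x ![fundamentalField E ξ x, v]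

/-! ### The reduction space at `0` -/

/-- The level set `Ψ⁻¹(0)` of a map `Ψ` defined on `V`. -/
def zeroLevel (Ψ : X → StrongDual ℝ (Fin n → ℝ)) (V : Set X) : Set X := {x | x ∈ V ∧ Ψ x = 0}

/-- Two points of `Ψ⁻¹(0)` are equivalent if they lie in the same `K`-orbit. -/
def levelSetoid (Ψ : X → StrongDual ℝ (Fin n → ℝ)) (V : Set X) : Setoid (zeroLevel Ψ V) where
  r a b := ∃ k : CompactTorus n, CompactTorus.incl n k • (a : X) = b
  iseqv :=
    { refl := fun a => ⟨1, by simp⟩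
      symm := by
        rintro a b ⟨k, hk⟩
        exact ⟨k⁻¹, by rw [← hk, smul_smul, ← map_mul]; simp⟩
      trans := by
        rintro a b c ⟨k, hk⟩ ⟨l, hl⟩
        exact ⟨l * k, by rw [map_mul, mul_smul, hk, hl]⟩ }

/-- The orbit space `Ψ⁻¹(0) / K` (the stabilizer of `0 ∈ 𝔨^*` is all of `K`), with the quotient
topology. -/
abbrev ReductionSpace (Ψ : X → StrongDual ℝ (Fin n → ℝ)) (V : Set X) : Type _ :=
  Quotient (levelSetoid Ψ V)

/-- The projection `π : Ψ⁻¹(0) → Ψ⁻¹(0) / K`. -/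
def ReductionSpace.proj (Ψ : X → StrongDual ℝ (Fin n → ℝ)) (V : Set X) :
    zeroLevel Ψ V → ReductionSpace Ψ V := Quotient.mk (levelSetoid Ψ V)

/-- The given complex manifold structure, modelled on `F`, on the orbit space `R = Ψ⁻¹(0) / K` and
the two-form `τ` on `R` are those of the reduction of the Hermitian form `Ω` at `0`:

* `0` is a regular value of `Ψ` and `K` acts freely on `Ψ⁻¹(0)`; thus `Ψ⁻¹(0)` is a submanifold,
  with tangent space `ker dΨ_x` at `x`;
* the projection `π : Ψ⁻¹(0) → R` is a smooth submersion (being smooth on the submanifold `Ψ⁻¹(0)`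
  means being the restriction of a smooth map near each point), which determines the smooth
  structure of `R`;
* the complex structure of `R` is the one induced from that of `X`: `dπ` is complex linear on the
  largest complex subspace `T_x Ψ⁻¹(0) ∩ J T_x Ψ⁻¹(0)` of `T_x Ψ⁻¹(0)`;
* `τ` is smooth and Hermitian, and `π^* τ` is the restriction of `Ω` to `Ψ⁻¹(0)`. -/
structure IsReductionStructure {F : Type*} [NormedAddCommGroup F] [NormedSpace ℂ F]
    (Ω : DiffForm E X 2) (Ψ : X → StrongDual ℝ (Fin n → ℝ)) (V : Set X)
    [ChartedSpace F (ReductionSpace Ψ V)] (τ : DiffForm F (ReductionSpace Ψ V) 2) : Prop where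
  complex : IsManifold 𝓘(ℂ, F) ω (ReductionSpace Ψ V)
  regular : ∀ x ∈ zeroLevel Ψ V,
    Function.Surjective (mfderiv 𝓘(ℝ, E) 𝓘(ℝ, StrongDual ℝ (Fin n → ℝ)) Ψ x)
  free : ∀ x ∈ zeroLevel Ψ V, ∀ k : CompactTorus n, CompactTorus.incl n k • x = x → k = 1
  form_smooth : τ.SmoothOn Set.univ
  form_hermitian : τ.HermitianOn Set.univ
  projection : ∀ x : zeroLevel Ψ V, ∃ (U : Set X) (q : X → ReductionSpace Ψ V),
    IsOpen U ∧ (x : X) ∈ U ∧ ContMDiffOn 𝓘(ℝ, E) 𝓘(ℝ, F) ∞ q U ∧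
    (∀ y : zeroLevel Ψ V, (y : X) ∈ U → q y = ReductionSpace.proj Ψ V y) ∧
    ∃ (T : Submodule ℝ E) (D : E →L[ℝ] F),
      T = LinearMap.ker
        (mfderiv 𝓘(ℝ, E) 𝓘(ℝ, StrongDual ℝ (Fin n → ℝ)) Ψ (x : X)).toLinearMap ∧
      D = mfderiv 𝓘(ℝ, E) 𝓘(ℝ, F) q (x : X) ∧
      (∀ z : F, ∃ v ∈ T, D v = z) ∧
      (∀ v ∈ T, Complex.I • v ∈ T → D (Complex.I • v) = Complex.I • D v) ∧
      ∀ v ∈ T, ∀ u ∈ T, Ω x ![v, u] = τ (ReductionSpace.proj Ψ V x) ![D v, D u]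

/-- The two-form `Ω` and the map `Ψ`, both on the `K`-invariant open set `V`, present the complex
manifold `Y` as a reduction: `Ω` is a smooth non-degenerate momentumly closed Hermitian two-form
on `V` with generalized moment map `Ψ`, and the reduction space of `Ψ` at `0` (with its complex
structure) is biholomorphic to `Y`. -/
structure PresentsAsReduction (F : Type*) [NormedAddCommGroup F] [NormedSpace ℂ F] (Y : Type*)
    [TopologicalSpace Y] [ChartedSpace F Y]
    (Ω : DiffForm E X 2) (Ψ : X → StrongDual ℝ (Fin n → ℝ)) (V : Set X) : Prop where
  isOpen : IsOpen V
  invariant : KInvariantSet n V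
  smooth : Ω.SmoothOn V
  nondegenerate : Ω.NondegenerateOn V
  hermitian : Ω.HermitianOn V
  momentumlyClosed : MomentumlyClosedOn n Ω V
  momentMap : IsGeneralizedMomentMapOn Ω Ψ V
  biholomorphic : ∃ (_ : ChartedSpace F (ReductionSpace Ψ V))
    (τ : DiffForm F (ReductionSpace Ψ V) 2), IsReductionStructure Ω Ψ V τ ∧
      Nonempty (Diffeomorph 𝓘(ℂ, F) 𝓘(ℂ, F) (ReductionSpace Ψ V) Y ω)

/-! ### Principal bundles -/

/-- `p : X → Y` is an analytic locally trivial principal bundle with group `G = (ℂˣ)ⁿ`: it is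
`G`-invariant, and over the members `U` of an open cover of `Y` there are `G`-equivariant
biholomorphic maps `p⁻¹(U) ≅ G × U` over `U`, where `G` is viewed as the open subset of `ℂⁿ` of the
vectors with non-zero coordinates and acts on itself by multiplication.  In particular `G` acts
holomorphically and freely on `X`, the fibres of `p` are the `G`-orbits, and `Y` is `X / G`. -/
structure IsAnalyticPrincipalBundle (n : ℕ) {E F : Type*} [NormedAddCommGroup E] [NormedSpace ℂ E]
    [NormedAddCommGroup F] [NormedSpace ℂ F] {X Y : Type*}
    [TopologicalSpace X] [ChartedSpace E X] [TopologicalSpace Y] [ChartedSpace F Y]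
    [MulAction (ComplexTorus n) X] (p : X → Y) : Prop where
  invariant : ∀ (g : ComplexTorus n) (x : X), p (g • x) = p x
  locallyTrivial : ∀ y : Y, ∃ (U : Set Y) (φ : OpenPartialHomeomorph X ((Fin n → ℂ) × Y)),
    IsOpen U ∧ y ∈ U ∧
    φ.source = p ⁻¹' U ∧
    φ.target = {z : Fin n → ℂ | ∀ j, z j ≠ 0} ×ˢ U ∧
    ContMDiffOn 𝓘(ℂ, E) (𝓘(ℂ, Fin n → ℂ).prod 𝓘(ℂ, F)) ω φ φ.source ∧
    ContMDiffOn (𝓘(ℂ, Fin n → ℂ).prod 𝓘(ℂ, F)) 𝓘(ℂ, E) ω φ.symm φ.target ∧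
    (∀ x ∈ p ⁻¹' U, (φ x).2 = p x) ∧
    ∀ (g : ComplexTorus n), ∀ x ∈ p ⁻¹' U, ∀ j, (φ (g • x)).1 j = (g j : ℂ) * (φ x).1 j

end Actions

end MomentReduction

end

noncomputable section

namespace MomentReduction

/-! ### Smoothness of pullbacks of alternating forms -/

section Alternating

variable {E F G H : Type*} [NormedAddCommGroup E] [NormedSpace ℝ E]
  [NormedAddCommGroup F] [NormedSpace ℝ F] [NormedAddCommGroup G] [NormedSpace ℝ G]
  [NormedAddCommGroup H] [NormedSpace ℝ H]

/-! The form lives on all of `X` and is built from a Hermitian form σ on `Y` together with Hermitian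
norms on the n line bundles associated with the principal bundle. The logarithms of these norms are
smooth functions φ_j on `X` with φ_j(g • x) = φ_j(x) + log |g_j|. They are glued from the local
functions log |z_j| by a partition of unity on `Y` (`exists_isLogNorm`). Put Ω = p^*σ + dd^c(½ ∑
φ_j²) and Ψ^ξ = -∑ ξ_j φ_j.

By the Leibniz rule Ω = p^*σ + ∑ (dφ_j ∧ d^cφ_j + φ_j dd^cφ_j) (`totalForm_apply`). Locally φ_j is a
function of the base point plus log |z_j|, and log |z_j| is pluriharmonic, so dd^cφ_j comes from the
base (`ddc_eq`). Hence ξ_X contracts p^*σ and dd^cφ_j to zero. Since dφ_j(ξ_X) = 0 and dφ_j(J ξ_X) =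
-ξ_j, what remains of the contraction is -∑ ξ_j dφ_j = dΨ^ξ (`totalForm_fundamentalField`). So Ω is
momentumly closed even when σ is not closed; and if σ is closed, so is Ω.

On Ψ⁻¹(0) all φ_j vanish, the curvature terms disappear, and Ω(v, Jv) = σ(dp v, J dp v) + ∑
(dφ_j(v)² + dφ_j(Jv)²) is positive (`totalForm_pos`). Positivity is an open condition
(`isOpen_positiveSet`), and V is the set where it holds. Each fibre of p meets Ψ⁻¹(0) in exactly one
K-orbit, because |g_j| can be adjusted to make φ_j vanish and the remaining freedom is |g_j| = 1. So
Ψ⁻¹(0)/K is homeomorphic to `Y` (`reductionHomeo`). On the kernel of dΨ, at points of the level, Ω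
restricts to p^*σ, so the transported structure is the reduced one (`exists_reductionStructure`).
The base form σ is any Hermitian form (`exists_hermitian`), or the given Kähler form in the second
part. -/

/-- The antisymmetrization of multilinear maps, as a continuous linear map. -/
def antisymmetrizeCLM (k : ℕ) (E : Type*) [NormedAddCommGroup E] [NormedSpace ℝ E] (G : Type*)
    [NormedAddCommGroup G] [NormedSpace ℝ G] :
    ContinuousMultilinearMap ℝ (fun _ : Fin k => E) G →L[ℝ] E [⋀^Fin k]→L[ℝ] G :=
  LinearMap.mkContinuous
    { toFun := fun f => ContinuousMultilinearMap.alternatization f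
      map_add' := fun f g => map_add _ f g
      map_smul' := fun c f => by
        ext v
        simp [ContinuousMultilinearMap.alternatization_apply_apply, Finset.smul_sum, smul_comm c] }
    (k.factorial : ℝ) (by
      intro f
      refine ContinuousAlternatingMap.opNorm_le_bound _ (by positivity) fun v => ?_
      simp only [LinearMap.coe_mk, AddHom.coe_mk,
        ContinuousMultilinearMap.alternatization_apply_apply]
      refine (norm_sum_le _ _).trans ?_
      have : ∀ σ ∈ (Finset.univ : Finset (Equiv.Perm (Fin k))),
          ‖Equiv.Perm.sign σ • f (v ∘ σ)‖ ≤ ‖f‖ * ∏ i, ‖v i‖ := by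
        intro σ _
        have h1 : ‖Equiv.Perm.sign σ • f (v ∘ σ)‖ = ‖f (v ∘ σ)‖ := by
          rcases Int.units_eq_one_or (Equiv.Perm.sign σ) with h | h <;> simp [h]
        rw [h1]
        refine (f.le_opNorm _).trans_eq ?_
        congr 1
        exact Equiv.prod_comp σ fun i => ‖v i‖
      refine (Finset.sum_le_sum this).trans_eq ?_
      simp [Fintype.card_perm, mul_assoc])

lemma antisymmetrizeCLM_apply {k : ℕ} (f : E [⋀^Fin k]→L[ℝ] G) :
    antisymmetrizeCLM k E G f.toContinuousMultilinearMap = (k.factorial : ℝ) • f := by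
  ext v
  simp only [antisymmetrizeCLM, LinearMap.mkContinuous_apply, LinearMap.coe_mk, AddHom.coe_mk,
    ContinuousMultilinearMap.alternatization_apply_apply]
  have : ∀ σ : Equiv.Perm (Fin k),
      Equiv.Perm.sign σ • f.toContinuousMultilinearMap (v ∘ σ) = f v := by
    intro σ
    have := f.toAlternatingMap.map_perm v σ
    change Equiv.Perm.sign σ • f.toAlternatingMap (v ∘ σ) = f.toAlternatingMap v
    rw [this, smul_smul]
    simp
  rw [Finset.sum_congr rfl fun σ _ => this σ]
  simp [Fintype.card_perm, Nat.cast_smul_eq_nsmul]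

/-- The inclusion of alternating into multilinear maps has the continuous linear left inverse
`(k!)⁻¹ • antisymmetrizeCLM`, so no smoothness is lost in either direction. -/
lemma contDiffAt_alternating_iff {k : ℕ} {n : WithTop ℕ∞} {f : H → E [⋀^Fin k]→L[ℝ] G} {x : H} :
    ContDiffAt ℝ n f x ↔ ContDiffAt ℝ n (fun y => (f y).toContinuousMultilinearMap) x := by
  refine ⟨fun h => (ContinuousAlternatingMap.toContinuousMultilinearMapLI (𝕜 := ℝ) (E := E)
    (F := G) (ι := Fin k)).contDiff.contDiffAt.comp x h, fun h => ?_⟩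
  have h1 := (antisymmetrizeCLM k E G).contDiff.contDiffAt.comp x h
  have h2 := h1.const_smul ((k.factorial : ℝ)⁻¹)
  refine h2.congr_of_eventuallyEq (Filter.Eventually.of_forall fun y => ?_)
  simp [antisymmetrizeCLM_apply, smul_smul, Nat.factorial_ne_zero]

/-- Substituting a linear map in every slot is the restriction to the diagonal of a continuous
multilinear map in the k substituted maps, hence smooth. -/
lemma contDiffAt_compContinuousLinearMap {k : ℕ} {n : WithTop ℕ∞} {α : H → F [⋀^Fin k]→L[ℝ] G}
    {A : H → E →L[ℝ] F} {x : H} (hα : ContDiffAt ℝ n α x) (hA : ContDiffAt ℝ n A x) :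
    ContDiffAt ℝ n (fun y => (α y).compContinuousLinearMap (A y)) x := by
  rw [contDiffAt_alternating_iff] at hα ⊢
  have h1 : ContDiffAt ℝ n (fun y =>
      ContinuousMultilinearMap.compContinuousLinearMapContinuousMultilinear ℝ
        (fun _ : Fin k => E) (fun _ => F) G (fun _ => A y)) x :=
    (ContinuousMultilinearMap.contDiff _).contDiffAt.comp x (contDiffAt_pi.2 fun _ => hA)
  exact h1.clm_apply hα

end Alternating

/-! ### Pullbacks of differential forms -/

section Pullback

variable {E F G : Type*} [NormedAddCommGroup E] [NormedSpace ℂ E]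
  [NormedAddCommGroup F] [NormedSpace ℂ F] [NormedAddCommGroup G] [NormedSpace ℂ G]
  {X Y Z : Type*} [TopologicalSpace X] [ChartedSpace E X] [TopologicalSpace Y] [ChartedSpace F Y]
  [TopologicalSpace Z] [ChartedSpace G Z] {k : ℕ}

/-- The pullback of a differential form under a map. -/
def DiffForm.pullback (f : X → Y) (α : DiffForm F Y k) : DiffForm E X k := fun x =>
  (α (f x)).compContinuousLinearMap (mfderiv 𝓘(ℝ, E) 𝓘(ℝ, F) f x)

/-- The form `α` is `C^n` at `x`. -/
def DiffForm.IsContDiffAt (n : WithTop ℕ∞) (α : DiffForm E X k) (x : X) : Prop :=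
  ContDiffAt ℝ n (α.inChart x) (extChartAt 𝓘(ℝ, E) x x)

namespace DiffForm

lemma inChart_eq_pullback (α : DiffForm E X k) (x : X) :
    α.inChart x = pullback (extChartAt 𝓘(ℝ, E) x).symm α := rfl

lemma inChart_self (α : DiffForm E E k) (e : E) : α.inChart e = α := by
  funext e'
  have h : ((extChartAt 𝓘(ℝ, E) e).symm : E → E) = id := by
    rw [extChartAt_model_space_eq_id]
    rfl
  rw [inChart_eq_pullback, h]
  simp only [pullback, mfderiv_id]
  rfl

lemma pullback_congr {f g : X → Y} {α : DiffForm F Y k} {x : X} (h : f =ᶠ[𝓝 x] g) :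
    pullback f α x = (pullback g α x : E [⋀^Fin k]→L[ℝ] ℝ) := by
  simp only [pullback]
  rw [h.mfderiv_eq, h.eq_of_nhds]

lemma pullback_comp {g : Y → Z} {f : X → Y} (α : DiffForm G Z k) {x : X}
    (hg : MDifferentiableAt 𝓘(ℝ, F) 𝓘(ℝ, G) g (f x)) (hf : MDifferentiableAt 𝓘(ℝ, E) 𝓘(ℝ, F) f x) :
    (pullback (g ∘ f) α : DiffForm E X k) x = pullback f (pullback g α : DiffForm F Y k) x := by
  simp only [pullback, mfderiv_comp x hg hf]
  rfl

lemma writtenInExtChartAt_contDiffAt {f : X → Y} {x : X} {n : WithTop ℕ∞}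
    (hf : ContMDiffAt 𝓘(ℝ, E) 𝓘(ℝ, F) n f x) :
    ContDiffAt ℝ n (writtenInExtChartAt 𝓘(ℝ, E) 𝓘(ℝ, F) x f) (extChartAt 𝓘(ℝ, E) x x) := by
  have := (contMDiffAt_iff.1 hf).2
  simpa [contDiffWithinAt_univ] using this

lemma pullback_model_eq (f : E → F) (α : DiffForm F F k) :
    (pullback f α : DiffForm E E k) =
      fun e => (α (f e)).compContinuousLinearMap (fderiv ℝ f e) := by
  funext e
  simp only [pullback, mfderiv_eq_fderiv]

lemma writtenInExtChartAt_self (f : X → Y) (x : X) :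
    writtenInExtChartAt 𝓘(ℝ, E) 𝓘(ℝ, F) x f (extChartAt 𝓘(ℝ, E) x x) =
      extChartAt 𝓘(ℝ, F) (f x) (f x) := by
  simp [writtenInExtChartAt]

variable [IsManifold 𝓘(ℝ, E) ∞ X]

lemma _root_.MomentReduction.mdifferentiableAt_chart_symm (x : X) {e : E}
    (he : e ∈ (extChartAt 𝓘(ℝ, E) x).target) :
    MDifferentiableAt 𝓘(ℝ, E) 𝓘(ℝ, E) (extChartAt 𝓘(ℝ, E) x).symm e :=
  ((contMDiffOn_extChartAt_symm (n := ∞) x).contMDiffAt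
    ((isOpen_extChartAt_target x).mem_nhds he)).mdifferentiableAt (by simp)

lemma _root_.MomentReduction.mdifferentiableAt_chart (x : X) {y : X}
    (hy : y ∈ (extChartAt 𝓘(ℝ, E) x).source) :
    MDifferentiableAt 𝓘(ℝ, E) 𝓘(ℝ, E) (extChartAt 𝓘(ℝ, E) x) y :=
  (contMDiffAt_extChartAt' (n := ∞) (by simpa using hy)).mdifferentiableAt (by simp)

/-- Being `C^∞` at a point need not hold on a neighbourhood, but being `C^1` at a point does; hence
the detour through order one. -/
lemma _root_.MomentReduction.eventually_mdifferentiableAt [IsManifold 𝓘(ℝ, F) ∞ Y] {f : X → Y}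
    {x : X} (hf : ContMDiffAt 𝓘(ℝ, E) 𝓘(ℝ, F) ∞ f x) :
    ∀ᶠ y in 𝓝 x, MDifferentiableAt 𝓘(ℝ, E) 𝓘(ℝ, F) f y := by
  have : IsManifold 𝓘(ℝ, E) 1 X := IsManifold.of_le (n := ∞) (by simp)
  have : IsManifold 𝓘(ℝ, F) 1 Y := IsManifold.of_le (n := ∞) (by simp)
  have h1 : ContMDiffAt 𝓘(ℝ, E) 𝓘(ℝ, F) 1 f x := hf.of_le (by simp)
  rw [contMDiffAt_iff_contMDiffAt_nhds (by simp)] at h1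
  filter_upwards [h1] with y hy using hy.mdifferentiableAt (by simp)

variable [IsManifold 𝓘(ℝ, F) ∞ Y]

/-- Reduces pullbacks between manifolds to pullbacks between vector spaces. The equality is only
local because the chart at `f x` cancels against its inverse only where `f` stays in its domain. -/
lemma pullback_inChart_eventuallyEq {f : X → Y} (α : DiffForm F Y k) {x : X}
    (hf : ContMDiffAt 𝓘(ℝ, E) 𝓘(ℝ, F) ∞ f x) :
    (pullback f α : DiffForm E X k).inChart x =ᶠ[𝓝 (extChartAt 𝓘(ℝ, E) x x)]
      pullback (writtenInExtChartAt 𝓘(ℝ, E) 𝓘(ℝ, F) x f) (α.inChart (f x)) := by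
  have hs : ContinuousAt (extChartAt 𝓘(ℝ, E) x).symm (extChartAt 𝓘(ℝ, E) x x) :=
    continuousAt_extChartAt_symm x
  have hs' : Filter.Tendsto (extChartAt 𝓘(ℝ, E) x).symm (𝓝 (extChartAt 𝓘(ℝ, E) x x)) (𝓝 x) := by
    simpa [ContinuousAt] using hs
  have h1 : ∀ᶠ y in 𝓝 x, f y ∈ (extChartAt 𝓘(ℝ, F) (f x)).source :=
    hf.continuousAt.eventually (extChartAt_source_mem_nhds (f x))
  filter_upwards [hs'.eventually (eventually_mdifferentiableAt hf), extChartAt_target_mem_nhds x,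
    (hs'.eventually h1).eventually_nhds] with e hd ht hy
  have hsd := mdifferentiableAt_chart_symm x ht
  have hcd := mdifferentiableAt_chart (f x) hy.self_of_nhds
  have hF : MDifferentiableAt 𝓘(ℝ, E) 𝓘(ℝ, F) (writtenInExtChartAt 𝓘(ℝ, E) 𝓘(ℝ, F) x f) e :=
    hcd.comp e (hd.comp e hsd)
  rw [inChart_eq_pullback, inChart_eq_pullback, ← pullback_comp α hd hsd, ← pullback_comp _ _ hF]
  · apply pullback_congr
    filter_upwards [hy] with e' he'
    simp only [Function.comp, writtenInExtChartAt]
    rw [PartialEquiv.left_inv _ he']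
  · exact mdifferentiableAt_chart_symm _ (PartialEquiv.map_source _ hy.self_of_nhds)

lemma IsContDiffAt.pullback {f : X → Y} {α : DiffForm F Y k} {x : X} {n : WithTop ℕ∞} (hn : n ≤ ∞)
    (hα : α.IsContDiffAt n (f x)) (hf : ContMDiffAt 𝓘(ℝ, E) 𝓘(ℝ, F) ∞ f x) :
    (pullback f α : DiffForm E X k).IsContDiffAt n x := by
  refine ContDiffAt.congr_of_eventuallyEq ?_ (pullback_inChart_eventuallyEq α hf)
  rw [pullback_model_eq]
  have hF := writtenInExtChartAt_contDiffAt hf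
  refine contDiffAt_compContinuousLinearMap ?_ ?_
  · refine ContDiffAt.comp (g := α.inChart (f x)) _ ?_ (hF.of_le hn)
    rw [writtenInExtChartAt_self]
    exact hα
  · exact (hF.fderiv_right (m := ∞) (by simp)).of_le hn

/-- In charts this is naturality of `extDeriv`. Applied to charts and their inverses it also shows
that `d` does not depend on the chart chosen at each point. -/
lemma d_pullback {f : X → Y} {α : DiffForm F Y k} {x : X}
    (hα : α.IsContDiffAt 1 (f x)) (hf : ContMDiffAt 𝓘(ℝ, E) 𝓘(ℝ, F) ∞ f x) :
    (pullback f α : DiffForm E X k).d x = pullback f α.d x := by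
  rw [DiffForm.d, (pullback_inChart_eventuallyEq α hf).extDeriv_eq, pullback_model_eq,
    extDeriv_pullback (r := ∞)]
  · rw [writtenInExtChartAt_self]
    simp only [DiffForm.pullback, DiffForm.d]
    congr 1
    rw [hf.mdifferentiableAt (by simp) |>.mfderiv]
    simp [fderivWithin_univ]
  · rw [writtenInExtChartAt_self]
    exact ContDiffAt.differentiableAt hα (by simp)
  · exact writtenInExtChartAt_contDiffAt hf
  · simp only [minSmoothness_of_isRCLikeNormedField]
    exact WithTop.coe_le_coe.2 le_top

end DiffForm

end Pullback

/-! ### Changing the chart, smoothness near a point, and d ∘ d = 0 -/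

section Calculus

variable {E F : Type*} [NormedAddCommGroup E] [NormedSpace ℂ E]
  [NormedAddCommGroup F] [NormedSpace ℂ F]
  {X Y : Type*} [TopologicalSpace X] [ChartedSpace E X] [TopologicalSpace Y] [ChartedSpace F Y]
  {k : ℕ}

lemma coe_extChartAt_self {W : Type*} [NormedAddCommGroup W] [NormedSpace ℝ W] (e : W) :
    (extChartAt 𝓘(ℝ, W) e : W → W) = id := by
  rw [extChartAt_model_space_eq_id]
  rfl

namespace DiffForm

lemma tendsto_chart_symm (x : X) :
    Filter.Tendsto (extChartAt 𝓘(ℝ, E) x).symm (𝓝 (extChartAt 𝓘(ℝ, E) x x)) (𝓝 x) := by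
  simpa [ContinuousAt] using continuousAt_extChartAt_symm (I := 𝓘(ℝ, E)) x

lemma inChart_eventuallyEq {α β : DiffForm E X k} {x : X} (h : α =ᶠ[𝓝 x] β) :
    α.inChart x =ᶠ[𝓝 (extChartAt 𝓘(ℝ, E) x x)] β.inChart x := by
  filter_upwards [(tendsto_chart_symm x).eventually h] with e he
  simp only [inChart, he]

lemma IsContDiffAt.congr {α β : DiffForm E X k} {x : X} {n : WithTop ℕ∞}
    (hβ : β.IsContDiffAt n x) (h : α =ᶠ[𝓝 x] β) : α.IsContDiffAt n x :=
  ContDiffAt.congr_of_eventuallyEq hβ (inChart_eventuallyEq h)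

lemma d_congr {α β : DiffForm E X k} {x : X} (h : α =ᶠ[𝓝 x] β) : α.d x = β.d x :=
  (inChart_eventuallyEq h).extDeriv_eq

lemma IsContDiffAt.of_le {α : DiffForm E X k} {x : X} {m n : WithTop ℕ∞}
    (hα : α.IsContDiffAt n x) (h : m ≤ n) : α.IsContDiffAt m x :=
  ContDiffAt.of_le hα h

lemma IsContDiffAt.add {α β : DiffForm E X k} {x : X} {n : WithTop ℕ∞}
    (hα : α.IsContDiffAt n x) (hβ : β.IsContDiffAt n x) : (α + β).IsContDiffAt n x :=
  ContDiffAt.add hα hβ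

lemma isContDiffAt_sum {ι : Type*} {s : Finset ι} {α : ι → DiffForm E X k} {x : X}
    {n : WithTop ℕ∞} (hα : ∀ i ∈ s, (α i).IsContDiffAt n x) :
    DiffForm.IsContDiffAt n (fun y => ∑ i ∈ s, α i y : DiffForm E X k) x := by
  have h : DiffForm.inChart (fun y => ∑ i ∈ s, α i y : DiffForm E X k) x =
      fun e => ∑ i ∈ s, (α i).inChart x e := by
    funext e
    exact map_sum (ContinuousAlternatingMap.compContinuousLinearMapCLM (F := ℝ) (ι := Fin k)
      (mfderiv 𝓘(ℝ, E) 𝓘(ℝ, E) (extChartAt 𝓘(ℝ, E) x).symm e : E →L[ℝ] E)) _ s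
  unfold IsContDiffAt
  rw [h]
  exact ContDiffAt.sum hα

lemma d_add {α β : DiffForm E X k} {x : X} (hα : α.IsContDiffAt 1 x) (hβ : β.IsContDiffAt 1 x) :
    (α + β).d x = α.d x + β.d x :=
  extDeriv_add (ContDiffAt.differentiableAt hα (by simp)) (ContDiffAt.differentiableAt hβ (by simp))

lemma SmoothOn.isContDiffAt {α : DiffForm E X k} (h : α.SmoothOn Set.univ) (x : X) :
    α.IsContDiffAt ∞ x := by
  refine (h x).contDiffAt ?_
  simpa using extChartAt_target_mem_nhds (I := 𝓘(ℝ, E)) x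

variable [IsManifold 𝓘(ℝ, E) ∞ X]

/-- `IsContDiffAt` and `d` at `y` use the preferred chart at `y`; this is the device for passing to
a fixed chart at `x` that contains `y`. -/
lemma eventuallyEq_pullback_chart (α : DiffForm E X k) (x : X) {y : X}
    (hy : y ∈ (extChartAt 𝓘(ℝ, E) x).source) :
    α =ᶠ[𝓝 y] pullback (extChartAt 𝓘(ℝ, E) x) (α.inChart x : DiffForm E E k) := by
  have ho : (extChartAt 𝓘(ℝ, E) x).source ∈ 𝓝 y := extChartAt_source_mem_nhds' hy
  filter_upwards [ho] with z hz
  rw [inChart_eq_pullback, ← pullback_comp _ _ (mdifferentiableAt_chart x hz)]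
  · have h : (extChartAt 𝓘(ℝ, E) x).symm ∘ (extChartAt 𝓘(ℝ, E) x) =ᶠ[𝓝 z] id := by
      filter_upwards [extChartAt_source_mem_nhds' hz] with w hw
      exact PartialEquiv.left_inv _ hw
    rw [pullback_congr h]
    simp only [pullback, mfderiv_id]
    rfl
  · exact mdifferentiableAt_chart_symm _ (PartialEquiv.map_source _ hz)

lemma isContDiffAt_of_inChart {α : DiffForm E X k} {x y : X} {n : WithTop ℕ∞} (hn : n ≤ ∞)
    (hy : y ∈ (extChartAt 𝓘(ℝ, E) x).source)
    (h : ContDiffAt ℝ n (α.inChart x) (extChartAt 𝓘(ℝ, E) x y)) : α.IsContDiffAt n y := by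
  refine IsContDiffAt.congr (IsContDiffAt.pullback hn ?_ ?_) (eventuallyEq_pullback_chart α x hy)
  · unfold IsContDiffAt
    rw [inChart_self, coe_extChartAt_self]
    exact h
  · exact contMDiffAt_extChartAt' (by simpa using hy)

lemma IsContDiffAt.inChart {α : DiffForm E X k} {x : X} {e : E} {n : WithTop ℕ∞} (hn : n ≤ ∞)
    (he : e ∈ (extChartAt 𝓘(ℝ, E) x).target)
    (h : α.IsContDiffAt n ((extChartAt 𝓘(ℝ, E) x).symm e)) : ContDiffAt ℝ n (α.inChart x) e := by
  have := IsContDiffAt.pullback hn h ((contMDiffOn_extChartAt_symm (n := ∞) x).contMDiffAt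
    ((isOpen_extChartAt_target x).mem_nhds he))
  unfold IsContDiffAt at this
  rw [inChart_self, ← inChart_eq_pullback, coe_extChartAt_self] at this
  exact this

lemma smoothOn_of_isContDiffAt {α : DiffForm E X k} {V : Set X}
    (h : ∀ x ∈ V, α.IsContDiffAt ∞ x) : α.SmoothOn V := fun _ _ he =>
  ((h _ he.2).inChart le_rfl he.1).contDiffWithinAt

lemma IsContDiffAt.eventually {α : DiffForm E X k} {x : X} (h : α.IsContDiffAt 1 x) :
    ∀ᶠ y in 𝓝 x, α.IsContDiffAt 1 y := by
  have h1 : ∀ᶠ e in 𝓝 (extChartAt 𝓘(ℝ, E) x x), ContDiffAt ℝ 1 (α.inChart x) e :=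
    ContDiffAt.eventually h (by simp)
  filter_upwards [(continuousAt_extChartAt (I := 𝓘(ℝ, E)) x).eventually h1,
    extChartAt_source_mem_nhds (I := 𝓘(ℝ, E)) x]
    with y hy hs
  exact isContDiffAt_of_inChart (by simp) hs hy

/-- The values of `α.d` at nearby points are defined through different charts. Naturality under the
inverse chart at `x` identifies them all with one `extDeriv`, from which d ∘ d = 0 and the
smoothness of dα follow. -/
lemma d_inChart_eventuallyEq {α : DiffForm E X k} {x : X} (h : α.IsContDiffAt 1 x) :
    α.d.inChart x =ᶠ[𝓝 (extChartAt 𝓘(ℝ, E) x x)] extDeriv (α.inChart x) := by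
  have h' : ∀ᶠ y in 𝓝 x, α.IsContDiffAt 1 y := h.eventually
  filter_upwards [(tendsto_chart_symm (E := E) x).eventually h',
    extChartAt_target_mem_nhds (I := 𝓘(ℝ, E)) x] with e he ht
  have hs := (contMDiffOn_extChartAt_symm (I := 𝓘(ℝ, E)) (n := ∞) x).contMDiffAt
    ((isOpen_extChartAt_target x).mem_nhds ht)
  rw [inChart_eq_pullback, ← d_pullback he hs, ← inChart_eq_pullback, DiffForm.d, inChart_self, coe_extChartAt_self]
  rfl

lemma d_d {α : DiffForm E X k} {x : X} (h : α.IsContDiffAt ∞ x) : α.d.d x = 0 := by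
  rw [DiffForm.d, (d_inChart_eventuallyEq (h.of_le (by simp))).extDeriv_eq]
  refine extDeriv_extDeriv_apply (r := ∞) h ?_
  simp only [minSmoothness_of_isRCLikeNormedField]
  exact WithTop.coe_le_coe.2 le_top

lemma IsContDiffAt.d {α : DiffForm E X k} {x : X} (h : α.IsContDiffAt ∞ x) :
    α.d.IsContDiffAt ∞ x := by
  refine ContDiffAt.congr_of_eventuallyEq ?_ (d_inChart_eventuallyEq (h.of_le (by simp)))
  have h1 : ContDiffAt ℝ ∞ (fderiv ℝ (α.inChart x)) (extChartAt 𝓘(ℝ, E) x x) :=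
    ContDiffAt.fderiv_right h (m := ∞) (by simp)
  exact (ContinuousAlternatingMap.alternatizeUncurryFinCLM ℝ E ℝ).contDiff.contDiffAt.comp _ h1

end DiffForm

/-! ### Functions as forms of degree zero -/

/-- A function, as a form of degree zero. -/
def zeroForm (f : X → ℝ) : DiffForm E X 0 := fun x =>
  ContinuousAlternatingMap.constOfIsEmpty ℝ E (Fin 0) (f x)

lemma zeroForm_inChart (f : X → ℝ) (x : X) :
    (zeroForm f : DiffForm E X 0).inChart x = fun e =>
      ContinuousAlternatingMap.constOfIsEmpty ℝ E (Fin 0) (f ((extChartAt 𝓘(ℝ, E) x).symm e)) := by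
  funext e
  ext v
  rfl

lemma contDiffAt_comp_chart_symm {f : X → ℝ} {x : X} {n : WithTop ℕ∞}
    (hf : ContMDiffAt 𝓘(ℝ, E) 𝓘(ℝ, ℝ) n f x) :
    ContDiffAt ℝ n (f ∘ (extChartAt 𝓘(ℝ, E) x).symm) (extChartAt 𝓘(ℝ, E) x x) := by
  have := (contMDiffAt_iff.1 hf).2
  rw [coe_extChartAt_self] at this
  simpa [contDiffWithinAt_univ] using this

lemma mfderiv_eq_fderiv_chart {f : X → ℝ} {x : X}
    (hf : MDifferentiableAt 𝓘(ℝ, E) 𝓘(ℝ, ℝ) f x) :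
    (mfderiv 𝓘(ℝ, E) 𝓘(ℝ, ℝ) f x : E →L[ℝ] ℝ) =
      fderiv ℝ (f ∘ (extChartAt 𝓘(ℝ, E) x).symm) (extChartAt 𝓘(ℝ, E) x x) := by
  rw [hf.mfderiv, writtenInExtChartAt, coe_extChartAt_self]
  simp [fderivWithin_univ]
  rfl

lemma zeroForm_isContDiffAt {f : X → ℝ} {x : X} {n : WithTop ℕ∞}
    (hf : ContMDiffAt 𝓘(ℝ, E) 𝓘(ℝ, ℝ) n f x) :
    (zeroForm f : DiffForm E X 0).IsContDiffAt n x := by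
  unfold DiffForm.IsContDiffAt
  rw [zeroForm_inChart]
  exact (ContinuousAlternatingMap.constOfIsEmptyLIE ℝ E ℝ (Fin 0)).contDiff.contDiffAt.comp _
    (contDiffAt_comp_chart_symm hf)

lemma zeroForm_d {f : X → ℝ} {x : X} (hf : MDifferentiableAt 𝓘(ℝ, E) 𝓘(ℝ, ℝ) f x) :
    (zeroForm f : DiffForm E X 0).d x =
      ContinuousAlternatingMap.ofSubsingleton ℝ E ℝ (0 : Fin 1)
        (mfderiv 𝓘(ℝ, E) 𝓘(ℝ, ℝ) f x : E →L[ℝ] ℝ) := by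
  rw [DiffForm.d, zeroForm_inChart, extDeriv_constOfIsEmpty, mfderiv_eq_fderiv_chart hf]
  rfl

end Calculus

/-! ### Real derivatives of maps between manifolds -/

section RealDerivative

variable {E F G : Type*} [NormedAddCommGroup E] [NormedSpace ℝ E]
  [NormedAddCommGroup F] [NormedSpace ℝ F] [NormedAddCommGroup G] [NormedSpace ℝ G]
  {X Y Z : Type*} [TopologicalSpace X] [ChartedSpace E X] [TopologicalSpace Y] [ChartedSpace F Y]
  [TopologicalSpace Z] [ChartedSpace G Z]

/-- The derivative of a map of manifolds at `x`, as a linear map between the model spaces. -/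
def rderiv (E F : Type*) [NormedAddCommGroup E] [NormedSpace ℝ E] [NormedAddCommGroup F]
    [NormedSpace ℝ F] {X Y : Type*} [TopologicalSpace X] [ChartedSpace E X] [TopologicalSpace Y]
    [ChartedSpace F Y] (f : X → Y) (x : X) : E →L[ℝ] F :=
  mfderiv 𝓘(ℝ, E) 𝓘(ℝ, F) f x

lemma rderiv_comp {g : Y → Z} {f : X → Y} {x : X}
    (hg : MDifferentiableAt 𝓘(ℝ, F) 𝓘(ℝ, G) g (f x))
    (hf : MDifferentiableAt 𝓘(ℝ, E) 𝓘(ℝ, F) f x) :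
    rderiv E G (g ∘ f) x = (rderiv F G g (f x)).comp (rderiv E F f x) :=
  mfderiv_comp x hg hf

lemma rderiv_congr {f g : X → Y} {x : X} (h : f =ᶠ[𝓝 x] g) : rderiv E F f x = rderiv E F g x :=
  h.mfderiv_eq

lemma rderiv_id (x : X) : rderiv E E (id : X → X) x = ContinuousLinearMap.id ℝ E := mfderiv_id

lemma rderiv_const (x : X) (c : Y) : rderiv E F (fun _ : X => c) x = 0 := mfderiv_const

lemma rderiv_eq_fderiv (f : E → F) (e : E) : rderiv E F f e = fderiv ℝ f e := mfderiv_eq_fderiv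

lemma rderiv_comp_model {g : F → G} {f : X → F} {x : X}
    (hg : DifferentiableAt ℝ g (f x))
    (hf : MDifferentiableAt 𝓘(ℝ, E) 𝓘(ℝ, F) f x) :
    rderiv E G (g ∘ f) x = (fderiv ℝ g (f x)).comp (rderiv E F f x) := by
  rw [rderiv_comp hg.mdifferentiableAt hf, rderiv_eq_fderiv]

end RealDerivative

/-! ### Complex manifolds as real manifolds -/

section Holomorphic

variable {E F : Type*} [NormedAddCommGroup E] [NormedSpace ℂ E]
  [NormedAddCommGroup F] [NormedSpace ℂ F]
  {X Y : Type*} [TopologicalSpace X] [ChartedSpace E X] [TopologicalSpace Y] [ChartedSpace F Y]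

lemma isManifold_real [IsManifold 𝓘(ℂ, E) ω X] : IsManifold 𝓘(ℝ, E) ∞ X := by
  refine isManifold_of_contDiffOn _ _ _ fun e e' he he' => ?_
  have h := StructureGroupoid.compatible (contDiffGroupoid ω 𝓘(ℂ, E)) he he'
  rw [contDiffGroupoid, mem_groupoid_of_pregroupoid] at h
  exact (ContDiffOn.restrict_scalars ℝ h.1).of_le le_top

lemma contMDiffAt_real {f : X → Y} {x : X} {n : WithTop ℕ∞}
    (hf : ContMDiffAt 𝓘(ℂ, E) 𝓘(ℂ, F) n f x) : ContMDiffAt 𝓘(ℝ, E) 𝓘(ℝ, F) n f x := by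
  rw [contMDiffAt_iff] at hf ⊢
  exact ⟨hf.1, hf.2.restrict_scalars ℝ⟩

lemma mdifferentiableAt_real {f : X → Y} {x : X}
    (hf : MDifferentiableAt 𝓘(ℂ, E) 𝓘(ℂ, F) f x) : MDifferentiableAt 𝓘(ℝ, E) 𝓘(ℝ, F) f x := by
  rw [mdifferentiableAt_iff] at hf ⊢
  exact ⟨hf.1, hf.2.restrictScalars ℝ⟩

lemma rderiv_apply_eq_mfderiv {f : X → Y} {x : X}
    (hf : MDifferentiableAt 𝓘(ℂ, E) 𝓘(ℂ, F) f x) (v : E) :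
    rderiv E F f x v = mfderiv 𝓘(ℂ, E) 𝓘(ℂ, F) f x v := by
  rw [rderiv, (mdifferentiableAt_real hf).mfderiv, hf.mfderiv]
  have h := hf.differentiableWithinAt_writtenInExtChartAt
  have h1 := h.hasFDerivWithinAt.restrictScalars ℝ
  have h2 := h1.fderivWithin (by simp)
  exact DFunLike.congr_fun h2 v

lemma rderiv_I_smul {f : X → Y} {x : X}
    (hf : MDifferentiableAt 𝓘(ℂ, E) 𝓘(ℂ, F) f x) (v : E) :
    rderiv E F f x (Complex.I • v) = Complex.I • rderiv E F f x v := by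
  rw [rderiv_apply_eq_mfderiv hf, rderiv_apply_eq_mfderiv hf]
  exact map_smul (mfderiv 𝓘(ℂ, E) 𝓘(ℂ, F) f x) Complex.I v

lemma mdifferentiableAt_complex_chart_symm [IsManifold 𝓘(ℂ, E) ω X] (x : X) {e : E}
    (he : e ∈ (extChartAt 𝓘(ℝ, E) x).target) :
    MDifferentiableAt 𝓘(ℂ, E) 𝓘(ℂ, E) (extChartAt 𝓘(ℝ, E) x).symm e :=
  ((contMDiffOn_extChartAt_symm (I := 𝓘(ℂ, E)) (n := ω) x).contMDiffAt
    ((isOpen_extChartAt_target x).mem_nhds he)).mdifferentiableAt (by simp)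

/-! ### The operator `dd^c` -/

/-- Multiplication by `i`, as a real linear map. -/
def mulI (E : Type*) [NormedAddCommGroup E] [NormedSpace ℂ E] : E →L[ℝ] E :=
  (Complex.I • ContinuousLinearMap.id ℂ E).restrictScalars ℝ

@[simp] lemma mulI_apply (v : E) : mulI E v = Complex.I • v := rfl

/-- The one-form `d^c f = - df ∘ J`. -/
def dc (f : X → ℝ) : DiffForm E X 1 := fun x =>
  ContinuousAlternatingMap.ofSubsingleton ℝ E ℝ (0 : Fin 1) (-(rderiv E ℝ f x).comp (mulI E))

lemma dc_apply (f : X → ℝ) (x : X) (v : Fin 1 → E) :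
    dc f x v = -rderiv E ℝ f x (Complex.I • v 0) := rfl

/-- The two-form `dd^c f`. -/
def ddc (f : X → ℝ) : DiffForm E X 2 := (dc f : DiffForm E X 1).d

lemma dc_eventuallyEq {f g : X → ℝ} {x : X} (h : f =ᶠ[𝓝 x] g) :
    (dc f : DiffForm E X 1) =ᶠ[𝓝 x] dc g := by
  filter_upwards [h.eventuallyEq_nhds] with y hy
  simp only [dc, rderiv_congr hy]

lemma ddc_congr {f g : X → ℝ} {x : X} (h : f =ᶠ[𝓝 x] g) :
    (ddc f : DiffForm E X 2) x = ddc g x :=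
  DiffForm.d_congr (dc_eventuallyEq h)

/-- The derivative of a holomorphic map commutes with J, so d^c is natural under holomorphic maps.
-/
lemma pullback_dc {g : X → Y} {f : Y → ℝ} {x : X} (hf : MDifferentiableAt 𝓘(ℝ, F) 𝓘(ℝ, ℝ) f (g x))
    (hg : MDifferentiableAt 𝓘(ℂ, E) 𝓘(ℂ, F) g x) :
    DiffForm.pullback g (dc f : DiffForm F Y 1) x = (dc (f ∘ g) : DiffForm E X 1) x := by
  ext v
  rw [dc_apply, rderiv_comp hf (mdifferentiableAt_real hg), ContinuousLinearMap.comp_apply,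
    rderiv_I_smul hg]
  rfl

variable [IsManifold 𝓘(ℂ, E) ω X]

lemma dc_inChart {f : X → ℝ} (x : X) {e : E} (he : e ∈ (extChartAt 𝓘(ℝ, E) x).target)
    (hf : MDifferentiableAt 𝓘(ℝ, E) 𝓘(ℝ, ℝ) f ((extChartAt 𝓘(ℝ, E) x).symm e)) :
    (dc f : DiffForm E X 1).inChart x e = ContinuousAlternatingMap.ofSubsingleton ℝ E ℝ (0 : Fin 1)
      (-(fderiv ℝ (f ∘ (extChartAt 𝓘(ℝ, E) x).symm) e).comp (mulI E)) := by
  rw [DiffForm.inChart_eq_pullback, pullback_dc hf (mdifferentiableAt_complex_chart_symm x he), dc,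
    rderiv_eq_fderiv]

lemma eventually_mdifferentiableAt_real {f : X → ℝ} {x : X} {n : WithTop ℕ∞} (hn : 1 ≤ n)
    (hf : ContMDiffAt 𝓘(ℝ, E) 𝓘(ℝ, ℝ) n f x) :
    ∀ᶠ y in 𝓝 x, MDifferentiableAt 𝓘(ℝ, E) 𝓘(ℝ, ℝ) f y := by
  have : IsManifold 𝓘(ℝ, E) ∞ X := isManifold_real
  have : IsManifold 𝓘(ℝ, E) 1 X := IsManifold.of_le (n := ∞) (by simp)
  have h1 : ContMDiffAt 𝓘(ℝ, E) 𝓘(ℝ, ℝ) 1 f x := hf.of_le hn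
  rw [contMDiffAt_iff_contMDiffAt_nhds (by simp)] at h1
  filter_upwards [h1] with y hy using hy.mdifferentiableAt (by simp)

lemma dc_inChart_eventuallyEq {f : X → ℝ} {x : X} (hf : ContMDiffAt 𝓘(ℝ, E) 𝓘(ℝ, ℝ) ∞ f x) :
    (dc f : DiffForm E X 1).inChart x =ᶠ[𝓝 (extChartAt 𝓘(ℝ, E) x x)] fun e =>
      ContinuousAlternatingMap.ofSubsingleton ℝ E ℝ (0 : Fin 1)
      (-(fderiv ℝ (f ∘ (extChartAt 𝓘(ℝ, E) x).symm) e).comp (mulI E)) := by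
  filter_upwards [(DiffForm.tendsto_chart_symm (E := E) x).eventually
    (eventually_mdifferentiableAt_real (by simp) hf),
    extChartAt_target_mem_nhds (I := 𝓘(ℝ, E)) x] with e he ht
  exact dc_inChart x ht he

lemma dc_isContDiffAt {f : X → ℝ} {x : X} (hf : ContMDiffAt 𝓘(ℝ, E) 𝓘(ℝ, ℝ) ∞ f x) :
    (dc f : DiffForm E X 1).IsContDiffAt ∞ x := by
  refine ContDiffAt.congr_of_eventuallyEq ?_ (dc_inChart_eventuallyEq hf)
  have h := (contDiffAt_comp_chart_symm hf).fderiv_right (m := ∞) (by simp)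
  refine (ContinuousAlternatingMap.ofSubsingletonLIE (𝕜 := ℝ) (E := E) (F := ℝ)
    (0 : Fin 1)).toContinuousLinearEquiv.contDiff.contDiffAt.comp _ ?_
  exact (h.clm_comp contDiffAt_const).neg

lemma ddc_isContDiffAt {f : X → ℝ} {x : X} (hf : ContMDiffAt 𝓘(ℝ, E) 𝓘(ℝ, ℝ) ∞ f x) :
    (ddc f : DiffForm E X 2).IsContDiffAt ∞ x := by
  have : IsManifold 𝓘(ℝ, E) ∞ X := isManifold_real
  exact (dc_isContDiffAt hf).d

/-- The form `dd^c f` in terms of the second derivative of `f` in a chart. -/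
lemma ddc_apply {f : X → ℝ} {x : X} (hf : ContMDiffAt 𝓘(ℝ, E) 𝓘(ℝ, ℝ) ∞ f x) (v u : E) :
    (ddc f : DiffForm E X 2) x ![v, u] =
      fderiv ℝ (fderiv ℝ (f ∘ (extChartAt 𝓘(ℝ, E) x).symm)) (extChartAt 𝓘(ℝ, E) x x) u
        (Complex.I • v) -
      fderiv ℝ (fderiv ℝ (f ∘ (extChartAt 𝓘(ℝ, E) x).symm)) (extChartAt 𝓘(ℝ, E) x x) v
        (Complex.I • u) := by
  set e₀ := extChartAt 𝓘(ℝ, E) x x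
  set g := f ∘ (extChartAt 𝓘(ℝ, E) x).symm
  have hg : DifferentiableAt ℝ (fderiv ℝ g) e₀ :=
    ((contDiffAt_comp_chart_symm hf).fderiv_right (m := ∞) (by simp)).differentiableAt (by simp)
  have h1 : ∀ w w' : E, fderiv ℝ (fun e => -fderiv ℝ g e (Complex.I • w)) e₀ w' =
      -fderiv ℝ (fderiv ℝ g) e₀ w' (Complex.I • w) := by
    intro w w'
    have h2 := ((hg.hasFDerivAt.clm_apply (hasFDerivAt_const (Complex.I • w) e₀)).neg).fderiv
    rw [show (fun e => -fderiv ℝ g e (Complex.I • w)) =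
      -fun e => fderiv ℝ g e (Complex.I • w) from rfl, h2]
    simp
  have hd : DifferentiableAt ℝ (fun e => ContinuousAlternatingMap.ofSubsingleton ℝ E ℝ (0 : Fin 1)
      (-(fderiv ℝ g e).comp (mulI E))) e₀ :=
    (ContinuousAlternatingMap.ofSubsingletonLIE (𝕜 := ℝ) (E := E) (F := ℝ)
      (0 : Fin 1)).toContinuousLinearEquiv.differentiable.differentiableAt.comp e₀ (hg.clm_comp (differentiableAt_const _)).neg
  rw [ddc, DiffForm.d, (dc_inChart_eventuallyEq hf).extDeriv_eq, extDeriv_apply hd, Fin.sum_univ_two]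
  have e1 := h1 u v
  have e2 := h1 v u
  -- Omitting the first slot leaves `u` and differentiates along `v`; omitting the second does the
  -- reverse, with opposite sign.
  change (-1 : ℤ) ^ 0 • fderiv ℝ (fun e => -fderiv ℝ g e (Complex.I • u)) e₀ v +
    (-1) ^ 1 • fderiv ℝ (fun e => -fderiv ℝ g e (Complex.I • v)) e₀ u = _
  rw [e1, e2]
  simp
  ring

/-- Symmetry of the second derivative together with J² = -1: the form has type (1,1). -/
lemma ddc_I_smul {f : X → ℝ} {x : X} (hf : ContMDiffAt 𝓘(ℝ, E) 𝓘(ℝ, ℝ) ∞ f x) (v u : E) :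
    (ddc f : DiffForm E X 2) x ![Complex.I • v, Complex.I • u] =
      (ddc f : DiffForm E X 2) x ![v, u] := by
  rw [ddc_apply hf, ddc_apply hf]
  have hs : IsSymmSndFDerivAt ℝ (f ∘ (extChartAt 𝓘(ℝ, E) x).symm) (extChartAt 𝓘(ℝ, E) x x) :=
    (contDiffAt_comp_chart_symm hf).isSymmSndFDerivAt
      (by simp only [minSmoothness_of_isRCLikeNormedField]; exact WithTop.coe_le_coe.2 le_top)
  rw [hs.eq u, hs.eq v]
  simp only [smul_smul, Complex.I_mul_I, neg_smul, one_smul, map_neg]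
  ring

lemma ddc_add {f g : X → ℝ} {x : X} (hf : ContMDiffAt 𝓘(ℝ, E) 𝓘(ℝ, ℝ) ∞ f x)
    (hg : ContMDiffAt 𝓘(ℝ, E) 𝓘(ℝ, ℝ) ∞ g x) :
    (ddc (f + g) : DiffForm E X 2) x = ddc f x + ddc g x := by
  have h : (dc (f + g) : DiffForm E X 1) =ᶠ[𝓝 x] dc f + dc g := by
    filter_upwards [eventually_mdifferentiableAt_real (by simp) hf,
      eventually_mdifferentiableAt_real (by simp) hg] with y hy hy'
    ext v
    have h1 : rderiv E ℝ (f + g) y = rderiv E ℝ f y + rderiv E ℝ g y := mfderiv_add hy hy'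
    rw [dc_apply, h1]
    simp only [add_apply, Pi.add_apply, ContinuousAlternatingMap.add_apply,
      dc_apply]
    ring
  rw [ddc, DiffForm.d_congr h]
  exact DiffForm.d_add ((dc_isContDiffAt hf).of_le (by simp)) ((dc_isContDiffAt hg).of_le (by simp))

lemma pullback_ddc [IsManifold 𝓘(ℂ, F) ω Y] {g : X → Y} {f : Y → ℝ} {x : X}
    (hf : ContMDiffAt 𝓘(ℝ, F) 𝓘(ℝ, ℝ) ∞ f (g x))
    (hg : ContMDiffAt 𝓘(ℂ, E) 𝓘(ℂ, F) ω g x) :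
    (ddc (f ∘ g) : DiffForm E X 2) x = DiffForm.pullback g (ddc f : DiffForm F Y 2) x := by
  have : IsManifold 𝓘(ℝ, E) ∞ X := isManifold_real
  have : IsManifold 𝓘(ℝ, F) ∞ Y := isManifold_real
  have hg' : ContMDiffAt 𝓘(ℝ, E) 𝓘(ℝ, F) ∞ g x := (contMDiffAt_real hg).of_le le_top
  rw [ddc, ddc, ← DiffForm.d_pullback ((dc_isContDiffAt hf).of_le (by simp)) hg']
  apply DiffForm.d_congr
  have h1 : ∀ᶠ y in 𝓝 x, ContMDiffAt 𝓘(ℂ, E) 𝓘(ℂ, F) 1 g y := by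
    have : IsManifold 𝓘(ℂ, E) 1 X := IsManifold.of_le (n := ω) le_top
    have : IsManifold 𝓘(ℂ, F) 1 Y := IsManifold.of_le (n := ω) le_top
    exact (contMDiffAt_iff_contMDiffAt_nhds (by simp)).1 (hg.of_le le_top)
  filter_upwards [hg.continuousAt.eventually (eventually_mdifferentiableAt_real (by simp) hf), h1]
    with y hy hy'
  exact (pullback_dc hy (hy'.mdifferentiableAt (by simp))).symm

/-- The second derivative of `∑ f_j² / 2`. -/
lemma ddc_sum_sq {ι : Type*} [Fintype ι] {f : ι → X → ℝ} {x : X}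
    (hf : ∀ j, ContMDiffAt 𝓘(ℝ, E) 𝓘(ℝ, ℝ) ∞ (f j) x) (v u : E) :
    (ddc (fun y => ∑ j, f j y ^ 2 / 2) : DiffForm E X 2) x ![v, u] =
      ∑ j, (rderiv E ℝ (f j) x u * rderiv E ℝ (f j) x (Complex.I • v) -
        rderiv E ℝ (f j) x v * rderiv E ℝ (f j) x (Complex.I • u) +
        f j x * (ddc (f j) : DiffForm E X 2) x ![v, u]) := by
  set e₀ := extChartAt 𝓘(ℝ, E) x x
  set g : ι → E → ℝ := fun j => f j ∘ (extChartAt 𝓘(ℝ, E) x).symm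
  have hg : ∀ j, ContDiffAt ℝ ∞ (g j) e₀ := fun j => contDiffAt_comp_chart_symm (hf j)
  have hρ : ContMDiffAt 𝓘(ℝ, E) 𝓘(ℝ, ℝ) ∞ (fun y => ∑ j, f j y ^ 2 / 2) x := by
    have h0 : ContDiff ℝ ∞ (fun w : ι → ℝ => ∑ j, w j ^ 2 / 2) := by fun_prop
    exact h0.contMDiff.contMDiffAt.comp x (contMDiffAt_pi_space.2 hf)
  have h1 : fderiv ℝ ((fun y => ∑ j, f j y ^ 2 / 2) ∘ (extChartAt 𝓘(ℝ, E) x).symm) =ᶠ[𝓝 e₀]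
      fun e => ∑ j, g j e • fderiv ℝ (g j) e := by
    have h2 : ∀ᶠ e in 𝓝 e₀, ∀ j, DifferentiableAt ℝ (g j) e := by
      rw [Filter.eventually_all]
      intro j
      filter_upwards [((hg j).of_le (m := 1) (by simp)).eventually (by simp)] with e he
      exact he.differentiableAt (by simp)
    filter_upwards [h2] with e he
    have h3 : HasFDerivAt (fun e => ∑ j, g j e ^ 2 / 2) (∑ j, g j e • fderiv ℝ (g j) e) e := by
      refine HasFDerivAt.fun_sum fun j _ => ?_
      have h4 := ((he j).hasFDerivAt.pow 2).mul_const (2⁻¹ : ℝ)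
      simp only [← div_eq_mul_inv] at h4
      refine h4.congr_fderiv ?_
      ext w
      simp
      ring
    exact h3.fderiv
  -- The Hessian of g²/2 is dg ⊗ dg + g D²g. Inserted in `ddc_apply`, the first part gives dg ∧ d^c
  -- g and the second g dd^c g.
  have h5 : ∀ w w' : E, fderiv ℝ (fderiv ℝ ((fun y => ∑ j, f j y ^ 2 / 2) ∘
      (extChartAt 𝓘(ℝ, E) x).symm)) e₀ w w' =
      ∑ j, (fderiv ℝ (g j) e₀ w * fderiv ℝ (g j) e₀ w' +
        g j e₀ * fderiv ℝ (fderiv ℝ (g j)) e₀ w w') := by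
    intro w w'
    have h6 : HasFDerivAt (fun e => ∑ j, g j e • fderiv ℝ (g j) e)
        (∑ j, (g j e₀ • fderiv ℝ (fderiv ℝ (g j)) e₀ +
          (fderiv ℝ (g j) e₀).smulRight (fderiv ℝ (g j) e₀))) e₀ := by
      refine HasFDerivAt.fun_sum fun j _ => ?_
      have h7 : DifferentiableAt ℝ (fderiv ℝ (g j)) e₀ :=
        ((hg j).fderiv_right (m := ∞) (by simp)).differentiableAt (by simp)
      exact ((hg j).differentiableAt (by simp)).hasFDerivAt.smul h7.hasFDerivAt
    rw [h1.fderiv_eq, h6.fderiv]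
    simp [add_comm]
  have h8 : ∀ j w, rderiv E ℝ (f j) x w = fderiv ℝ (g j) e₀ w := fun j w =>
    DFunLike.congr_fun (mfderiv_eq_fderiv_chart ((hf j).mdifferentiableAt (by simp))) w
  have h9 : ∀ j, f j x = g j e₀ := fun j => by simp [g, e₀]
  rw [ddc_apply hρ, h5, h5, ← Finset.sum_sub_distrib]
  refine Finset.sum_congr rfl fun j _ => ?_
  rw [ddc_apply (hf j), h8, h8, h8, h8, h9]
  ring

/-- If `f` is locally the real part of a holomorphic function, then `dd^c f = 0`. -/
lemma ddc_re_eq_zero {L : X → ℂ} {x : X} (hL : ContMDiffAt 𝓘(ℂ, E) 𝓘(ℂ, ℂ) ω L x) :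
    (ddc (fun y => (L y).re) : DiffForm E X 2) x = 0 := by
  have : IsManifold 𝓘(ℝ, E) ∞ X := isManifold_real
  have h1 : ∀ᶠ y in 𝓝 x, ContMDiffAt 𝓘(ℂ, E) 𝓘(ℂ, ℂ) 1 L y := by
    have : IsManifold 𝓘(ℂ, E) 1 X := IsManifold.of_le (n := ω) le_top
    exact (contMDiffAt_iff_contMDiffAt_nhds (by simp)).1 (hL.of_le le_top)
  have hL' : ContMDiffAt 𝓘(ℝ, E) 𝓘(ℝ, ℂ) ∞ L x := (contMDiffAt_real hL).of_le le_top
  have him : ContMDiffAt 𝓘(ℝ, E) 𝓘(ℝ, ℝ) ∞ (fun y => (L y).im) x :=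
    Complex.imCLM.contDiff.contMDiff.contMDiffAt.comp x hL'
  -- Cauchy–Riemann: d^c Re L = d Im L, since -Re(i dL(v)) = Im dL(v). So dd^c Re L = d d Im L = 0.
  have h2 : (dc (fun y => (L y).re) : DiffForm E X 1) =ᶠ[𝓝 x]
      (zeroForm fun y => (L y).im).d := by
    filter_upwards [h1, eventually_mdifferentiableAt_real (by simp) him] with y hy hy'
    have hd := hy.mdifferentiableAt (by simp)
    have hr := mdifferentiableAt_real hd
    rw [zeroForm_d hy']
    ext v
    rw [dc_apply]
    change _ = rderiv E ℝ (Complex.imCLM ∘ L) y (v 0)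
    change -rderiv E ℝ (Complex.reCLM ∘ L) y (Complex.I • v 0) = _
    rw [rderiv_comp_model Complex.reCLM.differentiableAt hr,
      rderiv_comp_model Complex.imCLM.differentiableAt hr]
    simp only [ContinuousLinearMap.fderiv, ContinuousLinearMap.comp_apply, rderiv_I_smul hd]
    simp
  rw [ddc, DiffForm.d_congr h2]
  exact DiffForm.d_d (zeroForm_isContDiffAt him)

/-- The logarithm of the absolute value of a holomorphic function is pluriharmonic. -/
lemma ddc_log_norm {z : X → ℂ} {x : X} (hz : ContMDiffAt 𝓘(ℂ, E) 𝓘(ℂ, ℂ) ω z x) (h0 : z x ≠ 0) :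
    (ddc (fun y => Real.log ‖z y‖) : DiffForm E X 2) x = 0 := by
  -- Dividing by `z x` moves the argument close to 1, away from the cut of the principal logarithm;
  -- the added constant restores the real part log |z|.
  have h1 : ContMDiffAt 𝓘(ℂ, E) 𝓘(ℂ, ℂ) ω (fun y => Complex.log (z y / z x) + Complex.log (z x)) x := by
    have h2 : ContDiffAt ℂ ω (fun w : ℂ => Complex.log (w / z x) + Complex.log (z x)) (z x) := by
      refine ContDiffAt.add ?_ contDiffAt_const
      exact ContDiffAt.comp (g := Complex.log) (z x) (Complex.contDiffAt_log (by simp [h0]))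
        (contDiffAt_id.div_const _)
    exact h2.contMDiffAt.comp x hz
  rw [← ddc_re_eq_zero h1]
  apply ddc_congr
  filter_upwards [hz.continuousAt.eventually_ne h0] with y hy
  rw [Complex.add_re, Complex.log_re, Complex.log_re, norm_div,
    Real.log_div (by simpa using hy) (by simpa using h0)]
  ring

end Holomorphic

/-! ### Local trivializations -/

section Trivialization

variable {n : ℕ} {E F : Type*} [NormedAddCommGroup E] [NormedSpace ℂ E]
  [NormedAddCommGroup F] [NormedSpace ℂ F] {X Y : Type*}
  [TopologicalSpace X] [ChartedSpace E X] [TopologicalSpace Y] [ChartedSpace F Y]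
  [MulAction (ComplexTorus n) X]

/-- A holomorphic trivialization of a principal bundle over `U`: the fibre coordinate `z` and the
parametrization `S` of the fibres over `U`. -/
structure HolTriv (n : ℕ) (E F : Type*) [NormedAddCommGroup E] [NormedSpace ℂ E]
    [NormedAddCommGroup F] [NormedSpace ℂ F] {X Y : Type*}
    [TopologicalSpace X] [ChartedSpace E X] [TopologicalSpace Y] [ChartedSpace F Y]
    [MulAction (ComplexTorus n) X] (p : X → Y) (U : Set Y) where
  z : X → Fin n → ℂ
  S : (Fin n → ℂ) × Y → X
  z_ne : ∀ x ∈ p ⁻¹' U, ∀ j, z x j ≠ 0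
  z_smul : ∀ (g : ComplexTorus n), ∀ x ∈ p ⁻¹' U, ∀ j, z (g • x) j = (g j : ℂ) * z x j
  p_S : ∀ w : Fin n → ℂ, (∀ j, w j ≠ 0) → ∀ y ∈ U, p (S (w, y)) = y
  z_S : ∀ w : Fin n → ℂ, (∀ j, w j ≠ 0) → ∀ y ∈ U, z (S (w, y)) = w
  S_eq : ∀ x ∈ p ⁻¹' U, S (z x, p x) = x
  z_smooth : ∀ x ∈ p ⁻¹' U, ContMDiffAt 𝓘(ℂ, E) 𝓘(ℂ, Fin n → ℂ) ω z x
  p_smooth : ∀ x ∈ p ⁻¹' U, ContMDiffAt 𝓘(ℂ, E) 𝓘(ℂ, F) ω p x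
  S_smooth : ∀ w : Fin n → ℂ, (∀ j, w j ≠ 0) → ∀ y ∈ U,
    ContMDiffAt (𝓘(ℂ, Fin n → ℂ).prod 𝓘(ℂ, F)) 𝓘(ℂ, E) ω S (w, y)

lemma isOpen_nonvanishing (n : ℕ) : IsOpen {z : Fin n → ℂ | ∀ j, z j ≠ 0} := by
  simp only [Set.ofPred_forall]
  exact isOpen_iInter_of_finite fun j => isOpen_ne.preimage (continuous_apply j)

lemma IsAnalyticPrincipalBundle.exists_holTriv {p : X → Y}
    (hp : IsAnalyticPrincipalBundle n (E := E) (F := F) p) (y : Y) :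
    ∃ U : Set Y, IsOpen U ∧ y ∈ U ∧ Nonempty (HolTriv n E F p U) := by
  obtain ⟨U, φ, hU, hy, hs, ht, h1, h2, h3, h4⟩ := hp.locallyTrivial y
  have hmem : ∀ w : Fin n → ℂ, (∀ j, w j ≠ 0) → ∀ y ∈ U, (w, y) ∈ φ.target := by
    intro w hw y hy
    rw [ht]
    exact ⟨hw, hy⟩
  have hφ : ∀ x ∈ p ⁻¹' U, ContMDiffAt 𝓘(ℂ, E) (𝓘(ℂ, Fin n → ℂ).prod 𝓘(ℂ, F)) ω φ x := by
    intro x hx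
    rw [← hs] at hx
    exact h1.contMDiffAt (φ.open_source.mem_nhds hx)
  have hpS : ∀ w : Fin n → ℂ, (∀ j, w j ≠ 0) → ∀ y ∈ U, p (φ.symm (w, y)) = y := by
    intro w hw y hy
    have h := φ.map_target (hmem w hw y hy)
    rw [hs] at h
    rw [← h3 _ h, φ.right_inv (hmem w hw y hy)]
  refine ⟨U, hU, hy, ⟨{
    z := fun x => (φ x).1
    S := φ.symm
    z_ne := fun x hx => ?_
    z_smul := h4
    p_S := hpS
    z_S := fun w hw y hy => by rw [φ.right_inv (hmem w hw y hy)]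
    S_eq := fun x hx => ?_
    z_smooth := fun x hx => contMDiffAt_fst.comp x (hφ x hx)
    p_smooth := fun x hx => ?_
    S_smooth := fun w hw y hy =>
      h2.contMDiffAt (φ.open_target.mem_nhds (hmem w hw y hy)) }⟩⟩
  · rw [← hs] at hx
    have := φ.map_source hx
    rw [ht] at this
    exact this.1
  · rw [← h3 x hx]
    exact φ.left_inv (by rwa [hs])
  · refine (contMDiffAt_snd.comp x (hφ x hx)).congr_of_eventuallyEq ?_
    -- Continuity of `p` is not yet available; the preimage is open because it is the source of the
    -- trivialization.
    have ho : p ⁻¹' U ∈ 𝓝 x := by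
      rw [← hs] at hx ⊢
      exact φ.open_source.mem_nhds hx
    filter_upwards [ho] with x' hx'
    exact (h3 x' hx').symm

namespace IsAnalyticPrincipalBundle

variable {p : X → Y} (hp : IsAnalyticPrincipalBundle n (E := E) (F := F) p)
include hp

lemma contMDiff : ContMDiff 𝓘(ℂ, E) 𝓘(ℂ, F) ω p := by
  intro x
  obtain ⟨U, -, hx, ⟨T⟩⟩ := hp.exists_holTriv (p x)
  exact T.p_smooth x hx

lemma continuous : Continuous p := hp.contMDiff.continuous

end IsAnalyticPrincipalBundle

namespace HolTriv

variable {p : X → Y} {U : Set Y} (T : HolTriv n E F p U)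
include T

lemma contMDiffAt_S_left {w : Fin n → ℂ} (hw : ∀ j, w j ≠ 0) {y : Y} (hy : y ∈ U) :
    ContMDiffAt 𝓘(ℂ, Fin n → ℂ) 𝓘(ℂ, E) ω (fun w' => T.S (w', y)) w :=
  ContMDiffAt.comp w (T.S_smooth w hw y hy) (contMDiffAt_id.prodMk contMDiffAt_const)

lemma contMDiffAt_S_right {w : Fin n → ℂ} (hw : ∀ j, w j ≠ 0) {y : Y} (hy : y ∈ U) :
    ContMDiffAt 𝓘(ℂ, F) 𝓘(ℂ, E) ω (fun y' => T.S (w, y')) y :=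
  ContMDiffAt.comp y (T.S_smooth w hw y hy) (contMDiffAt_const.prodMk contMDiffAt_id)

lemma smul_eq {x : X} (hx : x ∈ p ⁻¹' U) (hpg : ∀ (g : ComplexTorus n) x, p (g • x) = p x)
    (g : ComplexTorus n) : g • x = T.S (fun j => (g j : ℂ) * T.z x j, p x) := by
  have h : g • x ∈ p ⁻¹' U := by simpa [hpg] using hx
  rw [← T.S_eq _ h, hpg]
  congr
  funext j
  exact T.z_smul g x hx j

lemma mdifferentiableAt_z {x : X} (hx : x ∈ p ⁻¹' U) :
    MDifferentiableAt 𝓘(ℂ, E) 𝓘(ℂ, Fin n → ℂ) T.z x :=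
  (T.z_smooth x hx).mdifferentiableAt (by simp)

lemma mdifferentiableAt_p {x : X} (hx : x ∈ p ⁻¹' U) : MDifferentiableAt 𝓘(ℂ, E) 𝓘(ℂ, F) p x :=
  (T.p_smooth x hx).mdifferentiableAt (by simp)

/-- Near `x` the map `S` is a left inverse of `(z, p)`; differentiate. -/
lemma rderiv_injective (hU : IsOpen U) {x : X} (hx : x ∈ p ⁻¹' U) {v : E}
    (hz : rderiv E (Fin n → ℂ) T.z x v = 0) (hp : rderiv E F p x v = 0) : v = 0 := by
  have hd := (T.mdifferentiableAt_z hx).prodMk (T.mdifferentiableAt_p hx)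
  have hS := (T.S_smooth _ (T.z_ne x hx) (p x) hx).mdifferentiableAt (by simp)
  have hc := mfderiv_comp x (g := T.S) hS hd
  have hid : (T.S ∘ fun x => (T.z x, p x)) =ᶠ[𝓝 x] id := by
    filter_upwards [(T.p_smooth x hx).continuousAt.preimage_mem_nhds (hU.mem_nhds hx)] with x' hx'
    exact T.S_eq x' hx'
  rw [hid.mfderiv_eq, mfderiv_id, mfderiv_prodMk (T.mdifferentiableAt_z hx)
    (T.mdifferentiableAt_p hx)] at hc
  rw [rderiv_apply_eq_mfderiv (T.mdifferentiableAt_z hx)] at hz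
  rw [rderiv_apply_eq_mfderiv (T.mdifferentiableAt_p hx)] at hp
  have h1 := DFunLike.congr_fun hc v
  refine h1.trans ?_
  have h2 : ((mfderiv 𝓘(ℂ, E) 𝓘(ℂ, Fin n → ℂ) T.z x).prod (mfderiv 𝓘(ℂ, E) 𝓘(ℂ, F) p x)) v =
    (0 : (Fin n → ℂ) × F) := Prod.ext hz hp
  exact (congrArg (mfderiv (𝓘(ℂ, Fin n → ℂ).prod 𝓘(ℂ, F)) 𝓘(ℂ, E) T.S (T.z x, p x)) h2).trans
    (map_zero (mfderiv (𝓘(ℂ, Fin n → ℂ).prod 𝓘(ℂ, F)) 𝓘(ℂ, E) T.S (T.z x, p x)))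

/-- `S` is also a right inverse of `(z, p)`, so its derivative produces the vector. -/
lemma rderiv_surjective (hU : IsOpen U) {x : X} (hx : x ∈ p ⁻¹' U) (w : Fin n → ℂ) (u : F) :
    ∃ v : E, rderiv E (Fin n → ℂ) T.z x v = w ∧ rderiv E F p x v = u := by
  have hd := (T.mdifferentiableAt_z hx).prodMk (T.mdifferentiableAt_p hx)
  have hS := (T.S_smooth _ (T.z_ne x hx) (p x) hx).mdifferentiableAt (by simp)
  have hx' : T.S (T.z x, p x) = x := T.S_eq x hx
  have hc := mfderiv_comp (T.z x, p x) (g := fun x => (T.z x, p x)) (f := T.S)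
    (by rw [hx']; exact hd) hS
  have hid : ((fun x => (T.z x, p x)) ∘ T.S) =ᶠ[𝓝 (T.z x, p x)] id := by
    have : {z : Fin n → ℂ | ∀ j, z j ≠ 0} ×ˢ U ∈ 𝓝 (T.z x, p x) :=
      ((isOpen_nonvanishing n).prod hU).mem_nhds ⟨T.z_ne x hx, hx⟩
    filter_upwards [this] with q hq
    exact Prod.ext (T.z_S q.1 hq.1 q.2 hq.2) (T.p_S q.1 hq.1 q.2 hq.2)
  rw [hid.mfderiv_eq, mfderiv_id, hx', mfderiv_prodMk (T.mdifferentiableAt_z hx)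
    (T.mdifferentiableAt_p hx)] at hc
  let v : E := mfderiv (𝓘(ℂ, Fin n → ℂ).prod 𝓘(ℂ, F)) 𝓘(ℂ, E) T.S (T.z x, p x) (w, u)
  exact ⟨v, (rderiv_apply_eq_mfderiv (T.mdifferentiableAt_z hx) v).trans
    (congrArg Prod.fst (DFunLike.congr_fun hc (w, u))).symm,
    (rderiv_apply_eq_mfderiv (T.mdifferentiableAt_p hx) v).trans
    (congrArg Prod.snd (DFunLike.congr_fun hc (w, u))).symm⟩

end HolTriv

/-- Each `g` acts holomorphically because in a trivialization it multiplies the fibre coordinates by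
constants. -/
lemma IsAnalyticPrincipalBundle.contMDiff_smul {p : X → Y}
    (hp : IsAnalyticPrincipalBundle n (E := E) (F := F) p) (g : ComplexTorus n) :
    ContMDiff 𝓘(ℂ, E) 𝓘(ℂ, E) ω (fun x : X => g • x) := by
  intro x
  obtain ⟨U, hU, hx, ⟨T⟩⟩ := hp.exists_holTriv (p x)
  have hg : ∀ j, (g j : ℂ) * T.z x j ≠ 0 := fun j => mul_ne_zero (g j).ne_zero (T.z_ne x hx j)
  have h1 : ContMDiffAt 𝓘(ℂ, E) 𝓘(ℂ, Fin n → ℂ) ω (fun x => fun j => (g j : ℂ) * T.z x j) x := by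
    have h2 : ContDiff ℂ ω (fun w : Fin n → ℂ => fun j => (g j : ℂ) * w j) := by fun_prop
    exact h2.contMDiff.contMDiffAt.comp x (T.z_smooth x hx)
  have h3 := ContMDiffAt.comp x (g := T.S) (f := fun x => ((fun j => (g j : ℂ) * T.z x j), p x))
    (T.S_smooth _ hg (p x) hx) (h1.prodMk (T.p_smooth x hx))
  refine h3.congr_of_eventuallyEq ?_
  filter_upwards [hp.continuous.continuousAt.preimage_mem_nhds (hU.mem_nhds hx)] with x' hx'
  exact T.smul_eq hx' hp.invariant g

lemma IsAnalyticPrincipalBundle.exists_smul_eq {p : X → Y}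
    (hp : IsAnalyticPrincipalBundle n (E := E) (F := F) p) {x x' : X} (h : p x = p x') :
    ∃ g : ComplexTorus n, g • x = x' := by
  obtain ⟨U, hU, hx, ⟨T⟩⟩ := hp.exists_holTriv (p x)
  have hx' : p x' ∈ U := h ▸ hx
  refine ⟨fun j => Units.mk0 (T.z x' j / T.z x j) (div_ne_zero (T.z_ne x' hx' j) (T.z_ne x hx j)),
    ?_⟩
  rw [T.smul_eq hx hp.invariant]
  refine Eq.trans ?_ (T.S_eq x' hx')
  rw [h]
  congr
  funext j
  simp [div_mul_cancel₀ _ (T.z_ne x hx j)]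

lemma IsAnalyticPrincipalBundle.smul_eq_self {p : X → Y}
    (hp : IsAnalyticPrincipalBundle n (E := E) (F := F) p) {x : X} {g : ComplexTorus n}
    (h : g • x = x) : g = 1 := by
  obtain ⟨U, hU, hx, ⟨T⟩⟩ := hp.exists_holTriv (p x)
  funext j
  have := T.z_smul g x hx j
  rw [h] at this
  have h2 : (g j : ℂ) = 1 := by
    have h0 := T.z_ne x hx j
    field_simp at this
    exact this.symm
  exact Units.ext h2

lemma IsAnalyticPrincipalBundle.surjective {p : X → Y}
    (hp : IsAnalyticPrincipalBundle n (E := E) (F := F) p) : Function.Surjective p := by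
  intro y
  obtain ⟨U, hU, hy, ⟨T⟩⟩ := hp.exists_holTriv y
  exact ⟨T.S (1, y), T.p_S 1 (by simp) y hy⟩

end Trivialization

/-! ### Equivariant logarithms on the bundle -/

section LogNorm

variable {n : ℕ} {E F : Type*} [NormedAddCommGroup E] [NormedSpace ℂ E]
  [NormedAddCommGroup F] [NormedSpace ℂ F] {X Y : Type*}
  [TopologicalSpace X] [ChartedSpace E X] [TopologicalSpace Y] [ChartedSpace F Y]
  [MulAction (ComplexTorus n) X]

/-- Smooth functions `φ_j` with `φ_j (g • x) = φ_j x + log |g_j|`: the logarithms of hermitian norms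
on the line bundles associated with a principal bundle. -/
structure IsLogNorm (E : Type*) [NormedAddCommGroup E] [NormedSpace ℂ E] {X : Type*}
    [TopologicalSpace X] [ChartedSpace E X] [MulAction (ComplexTorus n) X]
    (φ : Fin n → X → ℝ) : Prop where
  smooth : ∀ j, ContMDiff 𝓘(ℝ, E) 𝓘(ℝ, ℝ) ∞ (φ j)
  smul : ∀ (g : ComplexTorus n) (x : X) (j : Fin n), φ j (g • x) = φ j x + Real.log ‖(g j : ℂ)‖

lemma HolTriv.contMDiffAt_log {p : X → Y} {U : Set Y} (T : HolTriv n E F p U) {x : X}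
    (hx : x ∈ p ⁻¹' U) (j : Fin n) :
    ContMDiffAt 𝓘(ℝ, E) 𝓘(ℝ, ℝ) ∞ (fun x => Real.log ‖T.z x j‖) x := by
  have h1 : ContMDiffAt 𝓘(ℝ, E) 𝓘(ℝ, Fin n → ℂ) ∞ T.z x :=
    (contMDiffAt_real (T.z_smooth x hx)).of_le le_top
  have h2 : ContDiffAt ℝ ∞ (fun w : Fin n → ℂ => Real.log ‖w j‖) (T.z x) := by
    have h3 : ContDiffAt ℝ ∞ (fun w : Fin n → ℂ => w j) (T.z x) := by fun_prop
    exact (h3.norm ℝ (T.z_ne x hx j)).log (by simpa using T.z_ne x hx j)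
  exact h2.contMDiffAt.comp x h1

/-- Each local function log |z_j| obeys the transformation law. The law is affine, and the weights χ
are functions on the base, constant on orbits, with sum 1; so the averaged function obeys it too. -/
lemma IsAnalyticPrincipalBundle.exists_isLogNorm [IsManifold 𝓘(ℂ, E) ω X]
    [FiniteDimensional ℂ F] [T2Space Y] [SecondCountableTopology Y] [IsManifold 𝓘(ℂ, F) ω Y]
    {p : X → Y} (hp : IsAnalyticPrincipalBundle n (E := E) (F := F) p) :
    ∃ φ : Fin n → X → ℝ, IsLogNorm E φ := by
  have : IsManifold 𝓘(ℝ, E) ∞ X := isManifold_real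
  have : IsManifold 𝓘(ℝ, F) ∞ Y := isManifold_real
  have : FiniteDimensional ℝ F := FiniteDimensional.complexToReal F
  have : LocallyCompactSpace Y := Manifold.locallyCompact_of_finiteDimensional 𝓘(ℝ, F)
  choose U hU hy T using hp.exists_holTriv
  have T := fun y => (T y).some
  obtain ⟨χ, hχ⟩ := SmoothPartitionOfUnity.exists_isSubordinate 𝓘(ℝ, F) isClosed_univ U hU
    (fun y _ => Set.mem_iUnion.2 ⟨y, hy y⟩)
  have hpr : ContMDiff 𝓘(ℝ, E) 𝓘(ℝ, F) ∞ p := fun x =>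
    (contMDiffAt_real (hp.contMDiff x)).of_le le_top
  have hmem : ∀ y x, χ y (p x) ≠ 0 → x ∈ p ⁻¹' (U y) := fun y x h =>
    hχ y (subset_tsupport _ h)
  have hfin : ∀ (c : Y → ℝ) (x : X), (Function.support fun y => χ y (p x) * c y).Finite :=
    fun c x => (χ.locallyFinite.point_finite (p x)).subset fun y hy => left_ne_zero_of_mul hy
  refine ⟨fun j x => ∑ᶠ y, χ y (p x) * Real.log ‖(T y).z x j‖, fun j => ?_, fun g x j => ?_⟩
  · refine contMDiff_finsum (fun y => ?_) ?_
    -- `z` is controlled only over `U y`, so smoothness is checked on the support of the product,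
    -- which lies over the support of χ_y.
    · refine contMDiff_of_tsupport fun x hx => ?_
      have hx' : p x ∈ tsupport (χ y) := by
        have h1 : tsupport (fun x => χ y (p x) * Real.log ‖(T y).z x j‖) ⊆
            p ⁻¹' tsupport (χ y) := by
          refine closure_minimal (fun x' hx' => ?_) ((isClosed_tsupport _).preimage hp.continuous)
          exact subset_tsupport _ (left_ne_zero_of_mul hx')
        exact h1 hx
      exact ((χ y).contMDiff.contMDiffAt.comp x hpr.contMDiffAt).mul
        ((T y).contMDiffAt_log (hχ y hx') j)
    · exact (χ.locallyFinite.preimage_continuous hp.continuous).subset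
        fun y x hx => left_ne_zero_of_mul hx
  · have h1 : ∀ y, χ y (p (g • x)) * Real.log ‖(T y).z (g • x) j‖ =
        χ y (p x) * Real.log ‖(T y).z x j‖ + χ y (p x) * Real.log ‖(g j : ℂ)‖ := by
      intro y
      rw [hp.invariant]
      by_cases h : χ y (p x) = 0
      · simp [h]
      · have h2 := hmem y x h
        rw [(T y).z_smul g x h2, norm_mul, Real.log_mul (by simp)
          (by simpa using (T y).z_ne x h2 j)]
        ring
    simp only [h1]
    rw [finsum_add_distrib (hfin _ x) (hfin _ x), ← finsum_mul, χ.sum_eq_one (Set.mem_univ _),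
      one_mul]

namespace IsLogNorm

variable {φ : Fin n → X → ℝ} (hφ : IsLogNorm E φ)
include hφ

lemma contMDiffAt (j : Fin n) (x : X) : ContMDiffAt 𝓘(ℝ, E) 𝓘(ℝ, ℝ) ∞ (φ j) x := hφ.smooth j x

lemma mdifferentiableAt (j : Fin n) (x : X) : MDifferentiableAt 𝓘(ℝ, E) 𝓘(ℝ, ℝ) (φ j) x :=
  (hφ.smooth j x).mdifferentiableAt (by simp)

lemma incl_smul (k : CompactTorus n) (x : X) (j : Fin n) :
    φ j (CompactTorus.incl n k • x) = φ j x := by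
  rw [hφ.smul]
  have : ‖((CompactTorus.incl n k j : ℂˣ) : ℂ)‖ = 1 := Circle.norm_coe (k j)
  simp [this]

variable {p : X → Y} {U : Set Y} (T : HolTriv n E F p U)
  (hpi : ∀ (g : ComplexTorus n) (x : X), p (g • x) = p x)
include T hpi

/-- The local form of the functions `φ_j`. -/
lemma eq_log_add {x : X} (hx : x ∈ p ⁻¹' U) (j : Fin n) :
    φ j x = φ j (T.S (1, p x)) + Real.log ‖T.z x j‖ := by
  have h1 : T.S (1, p x) ∈ p ⁻¹' U := by
    rw [Set.mem_preimage, T.p_S 1 (by simp) _ hx]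
    exact hx
  let g : ComplexTorus n := fun j => Units.mk0 (T.z x j) (T.z_ne x hx j)
  have h2 : g • T.S (1, p x) = x := by
    rw [T.smul_eq h1 hpi, T.z_S 1 (by simp) _ hx, T.p_S 1 (by simp) _ hx]
    simp only [g, Units.val_mk0, Pi.one_apply, mul_one]
    exact T.S_eq x hx
  have h3 := hφ.smul g (T.S (1, p x)) j
  rw [h2] at h3
  exact h3

lemma eventuallyEq (hU : IsOpen U) (hp : Continuous p) {x : X} (hx : x ∈ p ⁻¹' U) (j : Fin n) :
    φ j =ᶠ[𝓝 x] ((fun y => φ j (T.S (1, y))) ∘ p) + fun x => Real.log ‖T.z x j‖ := by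
  filter_upwards [(hU.preimage hp).mem_nhds hx] with x' hx'
  exact hφ.eq_log_add T hpi hx' j

omit hpi in
lemma contMDiffAt_section {y : Y} (hy : y ∈ U) (j : Fin n) :
    ContMDiffAt 𝓘(ℝ, F) 𝓘(ℝ, ℝ) ∞ (fun y => φ j (T.S (1, y))) y :=
  ContMDiffAt.comp y (hφ.contMDiffAt j _)
    ((contMDiffAt_real (T.contMDiffAt_S_right (w := 1) (by simp) hy)).of_le le_top)

/-- The fibre part log |z_j| is pluriharmonic, so only the part coming from the base contributes.
This is the curvature of the j-th line bundle, and it vanishes on vertical vectors. -/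
lemma ddc_eq [IsManifold 𝓘(ℂ, E) ω X] [IsManifold 𝓘(ℂ, F) ω Y] (hU : IsOpen U)
    (hp : Continuous p) {x : X} (hx : x ∈ p ⁻¹' U) (j : Fin n) :
    (ddc (φ j) : DiffForm E X 2) x =
      DiffForm.pullback p (ddc (fun y => φ j (T.S (1, y))) : DiffForm F Y 2) x := by
  have hs := hφ.contMDiffAt_section T hx j
  have hz : ContMDiffAt 𝓘(ℂ, E) 𝓘(ℂ, ℂ) ω (fun x => T.z x j) x :=
    contMDiffAt_pi_space.1 (T.z_smooth x hx) j
  have hpr := (contMDiffAt_real (T.p_smooth x hx)).of_le (m := ∞) le_top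
  rw [ddc_congr (hφ.eventuallyEq T hpi hU hp hx j), ddc_add (hs.comp x hpr) (T.contMDiffAt_log hx j),
    ddc_log_norm hz (T.z_ne x hx j), add_zero, pullback_ddc hs (T.p_smooth x hx)]

/-- The derivative of `φ_j` along vertical vectors. -/
lemma rderiv_vertical (hU : IsOpen U) (hp : Continuous p) {x : X} (hx : x ∈ p ⁻¹' U) (j : Fin n)
    {v : E} (hv : rderiv E F p x v = 0) :
    rderiv E ℝ (φ j) x v = (rderiv E (Fin n → ℂ) T.z x v j / T.z x j).re := by
  have hs := (hφ.contMDiffAt_section T hx j).mdifferentiableAt (by simp)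
  have hpr := mdifferentiableAt_real (T.mdifferentiableAt_p hx)
  have hzr := mdifferentiableAt_real (T.mdifferentiableAt_z hx)
  have hl := (T.contMDiffAt_log hx j).mdifferentiableAt (by simp)
  have h0 := T.z_ne x hx j
  have h1 : rderiv E ℝ (φ j) x = rderiv E ℝ ((fun y => φ j (T.S (1, y))) ∘ p) x +
      rderiv E ℝ (fun x => Real.log ‖T.z x j‖) x := by
    rw [rderiv_congr (hφ.eventuallyEq T hpi hU hp hx j)]
    exact mfderiv_add (hs.comp x hpr) hl
  -- Near `z x` the function log |w_j| is written as the real part of a holomorphic logarithm, whose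
  -- derivative at `z x` is dw_j / z_j(x).
  have h2 : HasFDerivAt (fun w : Fin n → ℂ => Complex.reCLM (Complex.log (w j / T.z x j)) +
        Real.log ‖T.z x j‖)
      (Complex.reCLM.comp (((T.z x j)⁻¹ • (ContinuousLinearMap.proj (R := ℂ) (φ := fun _ => ℂ) j
        : (Fin n → ℂ) →L[ℂ] ℂ)).restrictScalars ℝ)) (T.z x) := by
    have h3 : HasFDerivAt (fun w : Fin n → ℂ => Complex.log (w j / T.z x j))
        ((T.z x j)⁻¹ • (ContinuousLinearMap.proj (R := ℂ) (φ := fun _ => ℂ) j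
        : (Fin n → ℂ) →L[ℂ] ℂ)) (T.z x) := by
      have h4 : HasFDerivAt (fun w : Fin n → ℂ => w j / T.z x j)
          ((T.z x j)⁻¹ • (ContinuousLinearMap.proj (R := ℂ) (φ := fun _ => ℂ) j
          : (Fin n → ℂ) →L[ℂ] ℂ)) (T.z x) := by
        simp only [div_eq_mul_inv]
        exact ((ContinuousLinearMap.proj (R := ℂ) (φ := fun _ => ℂ) j).hasFDerivAt).mul_const _
      have h5 := h4.clog (by simp [h0])
      rw [div_self h0] at h5
      simpa using h5
    exact (Complex.reCLM.hasFDerivAt.comp (T.z x) (h3.restrictScalars ℝ)).add_const _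
  have h6 : (fun x => Real.log ‖T.z x j‖) =ᶠ[𝓝 x] (fun w : Fin n → ℂ =>
      Complex.reCLM (Complex.log (w j / T.z x j)) + Real.log ‖T.z x j‖) ∘ T.z := by
    have h7 : ContinuousAt (fun x => T.z x j) x :=
      (continuous_apply j).continuousAt.comp (T.z_smooth x hx).continuousAt
    filter_upwards [h7.eventually_ne h0] with x' hx'
    simp only [Function.comp, Complex.reCLM_apply, Complex.log_re, norm_div]
    rw [Real.log_div (by simpa using hx') (by simpa using h0)]
    ring
  rw [h1, add_apply, rderiv_comp hs hpr, ContinuousLinearMap.comp_apply, hv, map_zero, zero_add,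
    rderiv_congr h6, rderiv_comp_model h2.differentiableAt hzr, h2.fderiv]
  simp [div_eq_inv_mul]

/-- For vertical v, dφ_j(v) and dφ_j(Jv) are the real part and minus the imaginary part of
dz_j(v)/z_j. So they determine v; this makes the form definite along the fibres. -/
lemma rderiv_eq_zero_imp (hU : IsOpen U) (hp : Continuous p) {x : X} (hx : x ∈ p ⁻¹' U)
    {v : E} (hv : rderiv E F p x v = 0) (h1 : ∀ j, rderiv E ℝ (φ j) x v = 0)
    (h2 : ∀ j, rderiv E ℝ (φ j) x (Complex.I • v) = 0) : v = 0 := by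
  refine T.rderiv_injective hU hx ?_ hv
  funext j
  have hv' : rderiv E F p x (Complex.I • v) = 0 := by
    rw [rderiv_I_smul (T.mdifferentiableAt_p hx), hv, smul_zero]
  have e1 := h1 j
  have e2 := h2 j
  rw [hφ.rderiv_vertical T hpi hU hp hx j hv] at e1
  rw [hφ.rderiv_vertical T hpi hU hp hx j hv', rderiv_I_smul (T.mdifferentiableAt_z hx)] at e2
  have h0 := T.z_ne x hx j
  have e3 : rderiv E (Fin n → ℂ) T.z x v j / T.z x j = 0 := by
    refine Complex.ext e1 ?_
    simp only [Pi.smul_apply, smul_eq_mul, mul_div_assoc, Complex.mul_re, Complex.I_re,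
      Complex.I_im, zero_mul, one_mul, zero_sub, neg_eq_zero] at e2
    exact e2
  simpa [h0] using e3

/-- There are vectors with prescribed images under the derivatives of the projection and of
the `φ_j`. -/
lemma exists_rderiv_eq (hU : IsOpen U) (hp : Continuous p) {x : X} (hx : x ∈ p ⁻¹' U)
    (u : F) (t : Fin n → ℝ) :
    ∃ v : E, rderiv E F p x v = u ∧ ∀ j, rderiv E ℝ (φ j) x v = t j := by
  obtain ⟨v₁, -, h1⟩ := T.rderiv_surjective hU hx 0 u
  -- A vertical correction: dz_j(v₂) = c z_j with c real changes dφ_j by exactly c.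
  obtain ⟨v₂, h2, h3⟩ := T.rderiv_surjective hU hx
    (fun j => ((t j - rderiv E ℝ (φ j) x v₁ : ℝ) : ℂ) * T.z x j) 0
  refine ⟨v₁ + v₂, by rw [map_add, h1, h3, add_zero], fun j => ?_⟩
  rw [map_add, hφ.rderiv_vertical T hpi hU hp hx j h3, h2,
    mul_div_cancel_right₀ _ (T.z_ne x hx j), Complex.ofReal_re]
  ring

end IsLogNorm

/-! ### The fundamental fields -/

/-- `fundamentalField` is an `mfderiv`, which is zero by default; differentiability of the orbit
curve makes it the true velocity. -/
lemma HolTriv.mdifferentiableAt_exp_smul {p : X → Y} {U : Set Y} (T : HolTriv n E F p U)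
    (hpi : ∀ (g : ComplexTorus n) (x : X), p (g • x) = p x) {x : X} (hx : x ∈ p ⁻¹' U)
    (ξ : Fin n → ℝ) :
    MDifferentiableAt 𝓘(ℝ, ℝ) 𝓘(ℝ, E)
      (fun t : ℝ => CompactTorus.incl n (CompactTorus.exp (t • ξ)) • x) 0 := by
  have h1 : (fun t : ℝ => CompactTorus.incl n (CompactTorus.exp (t • ξ)) • x) =
      (fun w => T.S (w, p x)) ∘ fun t : ℝ => fun j => Complex.exp ((t * ξ j : ℝ) * Complex.I) *
        T.z x j := by
    funext t
    exact T.smul_eq hx hpi _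
  rw [h1]
  refine MDifferentiableAt.comp (0 : ℝ) ?_ (DifferentiableAt.mdifferentiableAt ?_)
  · refine mdifferentiableAt_real
      ((T.contMDiffAt_S_left ?_ hx).mdifferentiableAt (by simp))
    intro j
    simpa using T.z_ne x hx j
  · rw [differentiableAt_pi]
    intro j
    have : Differentiable ℝ fun t : ℝ => ((t * ξ j : ℝ) : ℂ) :=
      Complex.ofRealCLM.differentiable.comp (differentiable_id.mul_const (ξ j))
    fun_prop

lemma rderiv_fundamentalField {W : Type*} [NormedAddCommGroup W] [NormedSpace ℝ W]
    {Z : Type*} [TopologicalSpace Z] [ChartedSpace W Z] {p : X → Y}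
    (hp : IsAnalyticPrincipalBundle n (E := E) (F := F) p) {f : X → Z} {x : X}
    (hf : MDifferentiableAt 𝓘(ℝ, E) 𝓘(ℝ, W) f x) (ξ : Fin n → ℝ) :
    rderiv E W f x (fundamentalField E ξ x) = rderiv ℝ W
      (fun t : ℝ => f (CompactTorus.incl n (CompactTorus.exp (t • ξ)) • x)) 0 1 := by
  obtain ⟨U, hU, hx, ⟨T⟩⟩ := hp.exists_holTriv (p x)
  have h0 : CompactTorus.incl n (CompactTorus.exp ((0 : ℝ) • ξ)) • x = x := by
    have : CompactTorus.exp ((0 : ℝ) • ξ) = 1 := by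
      funext j
      simp [CompactTorus.exp]
    rw [this, map_one, one_smul]
  have h1 := rderiv_comp (g := f)
    (f := fun t : ℝ => CompactTorus.incl n (CompactTorus.exp (t • ξ)) • x) (x := 0)
    (by rw [h0]; exact hf) (T.mdifferentiableAt_exp_smul hp.invariant hx ξ)
  rw [h0] at h1
  exact (DFunLike.congr_fun h1 1).symm

section Fundamental

variable {p : X → Y} (hp : IsAnalyticPrincipalBundle n (E := E) (F := F) p)
include hp

lemma rderiv_p_fundamentalField (ξ : Fin n → ℝ) (x : X) :
    rderiv E F p x (fundamentalField E ξ x) = 0 := by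
  rw [rderiv_fundamentalField hp (mdifferentiableAt_real
    (hp.contMDiff.contMDiffAt.mdifferentiableAt (by simp)))]
  simp only [hp.invariant, rderiv_const]
  rfl

lemma IsLogNorm.rderiv_fundamentalField {φ : Fin n → X → ℝ} (hφ : IsLogNorm E φ) (ξ : Fin n → ℝ)
    (x : X) (j : Fin n) : rderiv E ℝ (φ j) x (fundamentalField E ξ x) = 0 := by
  rw [MomentReduction.rderiv_fundamentalField hp (hφ.mdifferentiableAt j x)]
  simp only [hφ.incl_smul, rderiv_const]
  rfl

/-- Along ξ_X one has dz_j = i ξ_j z_j, so along J ξ_X one has dz_j = -ξ_j z_j, and log |z_j|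
changes at rate -ξ_j. -/
lemma IsLogNorm.rderiv_I_fundamentalField {φ : Fin n → X → ℝ} (hφ : IsLogNorm E φ)
    (ξ : Fin n → ℝ) (x : X) (j : Fin n) :
    rderiv E ℝ (φ j) x (Complex.I • fundamentalField E ξ x) = -ξ j := by
  obtain ⟨U, hU, hx, ⟨T⟩⟩ := hp.exists_holTriv (p x)
  have h1 : rderiv E F p x (Complex.I • fundamentalField E ξ x) = 0 := by
    rw [rderiv_I_smul (T.mdifferentiableAt_p hx), rderiv_p_fundamentalField hp, smul_zero]
  have h2 : HasDerivAt (fun t : ℝ => T.z (CompactTorus.incl n (CompactTorus.exp (t • ξ)) • x))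
      (fun j => ((ξ j : ℂ) * Complex.I) * T.z x j) 0 := by
    rw [hasDerivAt_pi]
    intro j
    have h3 : (fun t : ℝ => T.z (CompactTorus.incl n (CompactTorus.exp (t • ξ)) • x) j) =
        fun t : ℝ => Complex.exp ((t : ℂ) * ((ξ j : ℂ) * Complex.I)) * T.z x j := by
      funext t
      rw [T.z_smul _ x hx]
      congr 1
      change Complex.exp ((t * ξ j : ℝ) * Complex.I) = _
      push_cast
      ring_nf
    rw [h3]
    have h4 : HasDerivAt (fun t : ℝ => (t : ℂ) * ((ξ j : ℂ) * Complex.I))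
        (1 * ((ξ j : ℂ) * Complex.I)) 0 := (Complex.ofRealCLM.hasDerivAt).mul_const _
    have h5 := (h4.cexp).mul_const (T.z x j)
    simpa using h5
  have h6 : rderiv E (Fin n → ℂ) T.z x (fundamentalField E ξ x) =
      fun j => ((ξ j : ℂ) * Complex.I) * T.z x j := by
    rw [MomentReduction.rderiv_fundamentalField hp
      (mdifferentiableAt_real (T.mdifferentiableAt_z hx)), rderiv_eq_fderiv]
    exact h2.deriv
  rw [hφ.rderiv_vertical T hp.invariant hU hp.continuous hx j h1,
    rderiv_I_smul (T.mdifferentiableAt_z hx), h6]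
  have h0 := T.z_ne x hx j
  have h7 : Complex.I • (fun j => ((ξ j : ℂ) * Complex.I) * T.z x j) = fun j => -(ξ j : ℂ) * T.z x j := by
    funext j
    simp only [Pi.smul_apply, smul_eq_mul]
    linear_combination ((ξ j : ℂ) * T.z x j) * Complex.I_mul_I
  rw [h7, mul_div_cancel_right₀ _ h0]
  simp

end Fundamental

end LogNorm

/-! ### Hermitian forms -/

section Hermitian

variable {F : Type*} [NormedAddCommGroup F] [NormedSpace ℂ F]
  {Y : Type*} [TopologicalSpace Y] [ChartedSpace F Y]

lemma DiffForm.IsContDiffAt.smul [IsManifold 𝓘(ℂ, F) ω Y] {k : ℕ} {α : DiffForm F Y k} {c : Y → ℝ}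
    {y : Y} (hα : α.IsContDiffAt ∞ y) (hc : ContMDiffAt 𝓘(ℝ, F) 𝓘(ℝ, ℝ) ∞ c y) :
    DiffForm.IsContDiffAt ∞ (fun y => c y • α y : DiffForm F Y k) y :=
  ContDiffAt.smul (contDiffAt_comp_chart_symm hc) hα

lemma rderiv_chart_injective [IsManifold 𝓘(ℂ, F) ω Y] (c : Y) {y : Y}
    (hy : y ∈ (extChartAt 𝓘(ℝ, F) c).source) {v : F}
    (hv : rderiv F F (extChartAt 𝓘(ℝ, F) c) y v = 0) : v = 0 := by
  have : IsManifold 𝓘(ℝ, F) ∞ Y := isManifold_real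
  have h1 := rderiv_comp (x := y) (mdifferentiableAt_chart_symm (X := Y) (E := F) c
    (PartialEquiv.map_source _ hy)) (mdifferentiableAt_chart c hy)
  have h : (extChartAt 𝓘(ℝ, F) c).symm ∘ (extChartAt 𝓘(ℝ, F) c) =ᶠ[𝓝 y] id := by
    filter_upwards [extChartAt_source_mem_nhds' hy] with w hw
    exact PartialEquiv.left_inv _ hw
  rw [rderiv_congr h, rderiv_id] at h1
  have h2 := DFunLike.congr_fun h1 v
  rw [ContinuousLinearMap.comp_apply, hv, map_zero] at h2
  exact h2

/-- Around each point there is a smooth positive two-form of type `(1,1)`. -/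
lemma exists_local_hermitian [IsManifold 𝓘(ℂ, F) ω Y] [FiniteDimensional ℂ F] (c : Y) :
    ∃ α : DiffForm F Y 2, ∀ y ∈ (extChartAt 𝓘(ℝ, F) c).source, α.IsContDiffAt ∞ y ∧
      (∀ v u : F, α y ![Complex.I • v, Complex.I • u] = α y ![v, u]) ∧
      ∀ v : F, v ≠ 0 → 0 < α y ![v, Complex.I • v] := by
  let l : F ≃L[ℂ] (Fin (Module.finrank ℂ F) → ℂ) :=
    ContinuousLinearEquiv.ofFinrankEq (by simp)
  let L : Fin (Module.finrank ℂ F) → Y → ℂ := fun k y => l (extChartAt 𝓘(ℝ, F) c y) k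
  have hch : ∀ y ∈ (extChartAt 𝓘(ℝ, F) c).source,
      ContMDiffAt 𝓘(ℂ, F) 𝓘(ℂ, F) ω (extChartAt 𝓘(ℝ, F) c) y := fun y hy =>
    contMDiffAt_extChartAt' (I := 𝓘(ℂ, F)) (by simpa using hy)
  have hL : ∀ k, ∀ y ∈ (extChartAt 𝓘(ℝ, F) c).source, ContMDiffAt 𝓘(ℂ, F) 𝓘(ℂ, ℂ) ω (L k) y := by
    intro k y hy
    have h1 : ContDiff ℂ ω fun w : F => l w k := by fun_prop
    exact h1.contMDiff.contMDiffAt.comp y (hch y hy)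
  have hre : ∀ k, ∀ y ∈ (extChartAt 𝓘(ℝ, F) c).source,
      ContMDiffAt 𝓘(ℝ, F) 𝓘(ℝ, ℝ) ∞ (fun y => (L k y).re) y := fun k y hy =>
    Complex.reCLM.contDiff.contMDiff.contMDiffAt.comp y ((contMDiffAt_real (hL k y hy)).of_le le_top)
  have hd : ∀ k, ∀ y ∈ (extChartAt 𝓘(ℝ, F) c).source, ∀ v,
      rderiv F ℝ (fun y => (L k y).re) y v = (l (rderiv F F (extChartAt 𝓘(ℝ, F) c) y v) k).re := by
    intro k y hy v
    let A : F →L[ℝ] ℝ := Complex.reCLM.comp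
      ((((ContinuousLinearMap.proj (R := ℂ) (φ := fun _ => ℂ) k).comp
        (l : F →L[ℂ] (Fin (Module.finrank ℂ F) → ℂ))) : F →L[ℂ] ℂ).restrictScalars ℝ)
    change rderiv F ℝ (A ∘ extChartAt 𝓘(ℝ, F) c) y v = _
    rw [rderiv_comp_model A.differentiableAt
      (mdifferentiableAt_real ((hch y hy).mdifferentiableAt (by simp))), ContinuousLinearMap.fderiv]
    rfl
  have hρ : ∀ y ∈ (extChartAt 𝓘(ℝ, F) c).source,
      ContMDiffAt 𝓘(ℝ, F) 𝓘(ℝ, ℝ) ∞ (fun y => ∑ k, (L k y).re ^ 2 / 2) y := by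
    intro y hy
    have h0 : ContDiff ℝ ∞ (fun w : Fin (Module.finrank ℂ F) → ℝ => ∑ j, w j ^ 2 / 2) := by fun_prop
    exact h0.contMDiff.contMDiffAt.comp y (contMDiffAt_pi_space.2 fun k => hre k y hy)
  -- With L_k the complex coordinates, Re L_k is pluriharmonic, so dd^c of this potential takes the
  -- value ∑ |dL_k(v)|² on (v, Jv).
  refine ⟨ddc fun y => ∑ k, (L k y).re ^ 2 / 2, fun y hy => ⟨ddc_isContDiffAt (hρ y hy),
    ddc_I_smul (hρ y hy), fun v hv => ?_⟩⟩
  rw [ddc_sum_sq (f := fun k y => (L k y).re) fun k => hre k y hy]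
  have hI : Complex.I • Complex.I • v = -v := by rw [smul_smul, Complex.I_mul_I, neg_one_smul]
  have hterm : ∀ k, rderiv F ℝ (fun y => (L k y).re) y (Complex.I • v) *
      rderiv F ℝ (fun y => (L k y).re) y (Complex.I • v) -
      rderiv F ℝ (fun y => (L k y).re) y v *
      rderiv F ℝ (fun y => (L k y).re) y (Complex.I • Complex.I • v) +
      (L k y).re * (ddc (fun y => (L k y).re) : DiffForm F Y 2) y ![v, Complex.I • v] =
      Complex.normSq (l (rderiv F F (extChartAt 𝓘(ℝ, F) c) y v) k) := by
    intro k
    rw [ddc_re_eq_zero (hL k y hy), hI, map_neg, hd k y hy, hd k y hy,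
      rderiv_I_smul ((hch y hy).mdifferentiableAt (by simp)), map_smul, Complex.normSq_apply]
    simp
    ring
  simp only [hterm]
  have hne : l (rderiv F F (extChartAt 𝓘(ℝ, F) c) y v) ≠ 0 := by
    intro h
    exact hv (rderiv_chart_injective c hy (by simpa using h))
  obtain ⟨k, hk⟩ := Function.ne_iff.1 hne
  exact Finset.sum_pos' (fun k _ => Complex.normSq_nonneg _)
    ⟨k, Finset.mem_univ k, Complex.normSq_pos.2 hk⟩

/-- J-invariance and positivity survive convex combinations, so the local forms can be glued. -/
lemma exists_hermitian [IsManifold 𝓘(ℂ, F) ω Y] [FiniteDimensional ℂ F] [T2Space Y]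
    [SecondCountableTopology Y] :
    ∃ σ : DiffForm F Y 2, σ.SmoothOn Set.univ ∧ σ.HermitianOn Set.univ := by
  have : IsManifold 𝓘(ℝ, F) ∞ Y := isManifold_real
  have : FiniteDimensional ℝ F := FiniteDimensional.complexToReal F
  have : LocallyCompactSpace Y := Manifold.locallyCompact_of_finiteDimensional 𝓘(ℝ, F)
  choose α hα using exists_local_hermitian (F := F) (Y := Y)
  obtain ⟨χ, hχ⟩ := SmoothPartitionOfUnity.exists_isSubordinate 𝓘(ℝ, F) isClosed_univ
    (fun y : Y => (extChartAt 𝓘(ℝ, F) y).source) (fun y => isOpen_extChartAt_source y)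
    (fun y _ => Set.mem_iUnion.2 ⟨y, mem_extChartAt_source y⟩)
  let σ : DiffForm F Y 2 := fun y => ∑ i ∈ χ.finsupport y, χ i y • α i y
  have hev : ∀ (y : Y) (v : Fin 2 → F), σ y v = ∑ i ∈ χ.finsupport y, χ i y * α i y v := by
    intro y v
    simp [σ, ContinuousAlternatingMap.sum_apply]
  have hmem : ∀ y, ∀ i ∈ χ.finsupport y, y ∈ (extChartAt 𝓘(ℝ, F) i).source := fun y i hi =>
    hχ i (subset_tsupport _ ((χ.mem_finsupport y).1 hi))
  refine ⟨σ, DiffForm.smoothOn_of_isContDiffAt fun y _ => ?_, fun y _ => ⟨fun v u => ?_, fun v hv => ?_⟩⟩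
  -- The index set in σ varies with the point; near `y` it is replaced by one fixed finite set, the
  -- additional terms being zero.
  · have h1 : σ =ᶠ[𝓝 y] fun y' => ∑ i ∈ χ.fintsupport y, χ i y' • α i y' := by
      filter_upwards [χ.eventually_finsupport_subset y] with y' hy'
      refine Finset.sum_subset hy' fun i _ hi => ?_
      have : χ i y' = 0 := by simpa [χ.mem_finsupport] using hi
      rw [this, zero_smul]
    refine DiffForm.IsContDiffAt.congr (DiffForm.isContDiffAt_sum
      (α := fun i y' => χ i y' • α i y') fun i hi => ?_) h1
    exact ((hα i y (hχ i ((χ.mem_fintsupport_iff y i).1 hi))).1).smul (χ i).contMDiff.contMDiffAt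
  · rw [hev, hev]
    exact Finset.sum_congr rfl fun i hi => by rw [(hα i y (hmem y i hi)).2.1]
  · rw [hev]
    obtain ⟨i, hi⟩ := χ.exists_pos_of_mem (Set.mem_univ y)
    refine Finset.sum_pos (fun i hi => mul_pos ?_ ((hα i y (hmem y i hi)).2.2 v hv))
      ⟨i, (χ.mem_finsupport y).2 hi.ne'⟩
    exact lt_of_le_of_ne (χ.nonneg i y) (Ne.symm ((χ.mem_finsupport y).1 hi))

end Hermitian

/-! ### The set where a form is positive -/

section Positive

variable {E : Type*} [NormedAddCommGroup E] [NormedSpace ℂ E]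
  {X : Type*} [TopologicalSpace X] [ChartedSpace E X]

/-- The set of points at which the quadratic form `v ↦ α (v, J v)` is positive definite. -/
def DiffForm.positiveSet (α : DiffForm E X 2) : Set X :=
  {x | ∀ v : E, v ≠ 0 → 0 < α x ![v, Complex.I • v]}

/-- Positivity on the compact unit sphere persists under small changes of the form, and homogeneity
extends it to all nonzero vectors. -/
lemma DiffForm.isOpen_positiveSet [IsManifold 𝓘(ℂ, E) ω X] [FiniteDimensional ℂ E]
    {α : DiffForm E X 2} (hα : ∀ x, α.IsContDiffAt ∞ x) : IsOpen α.positiveSet := by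
  have : IsManifold 𝓘(ℝ, E) ∞ X := isManifold_real
  have : FiniteDimensional ℝ E := FiniteDimensional.complexToReal E
  have : ProperSpace E := FiniteDimensional.proper ℝ E
  rw [isOpen_iff_mem_nhds]
  intro x₀ hx₀
  -- The preferred chart, hence the identification of the tangent space with `E`, may jump with `x`.
  -- The form is therefore compared in the fixed chart at x₀, whose derivative is complex linear.
  have hpull : ∀ x ∈ (extChartAt 𝓘(ℝ, E) x₀).source, ∀ v : E, α x ![v, Complex.I • v] =
      α.inChart x₀ (extChartAt 𝓘(ℝ, E) x₀ x) ![rderiv E E (extChartAt 𝓘(ℝ, E) x₀) x v,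
        Complex.I • rderiv E E (extChartAt 𝓘(ℝ, E) x₀) x v] := by
    intro x hx v
    have h1 := (eventuallyEq_pullback_chart α x₀ hx).eq_of_nhds
    have hch : MDifferentiableAt 𝓘(ℂ, E) 𝓘(ℂ, E) (extChartAt 𝓘(ℝ, E) x₀) x :=
      (contMDiffAt_extChartAt' (I := 𝓘(ℂ, E)) (n := ω) (by simpa using hx)).mdifferentiableAt
        (by simp)
    rw [← rderiv_I_smul hch, h1]
    simp only [pullback]
    refine congrArg (α.inChart x₀ (extChartAt 𝓘(ℝ, E) x₀ x)) ?_
    funext i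
    fin_cases i <;> rfl
  have hcont : ContinuousAt (α.inChart x₀) (extChartAt 𝓘(ℝ, E) x₀ x₀) :=
    ContDiffAt.continuousAt (hα x₀)
  have hpos0 : ∀ v : E, v ≠ 0 →
      0 < α.inChart x₀ (extChartAt 𝓘(ℝ, E) x₀ x₀) ![v, Complex.I • v] := by
    intro v hv
    -- Tangent vectors at x₀ are coordinatized by this very chart, so its derivative there is the
    -- identity.
    have hid : rderiv E E (extChartAt 𝓘(ℝ, E) x₀) x₀ v = v := by
      have h1 : (rderiv E E (extChartAt 𝓘(ℝ, E) x₀) x₀) = ContinuousLinearMap.id ℝ E := by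
        have hd := mdifferentiableAt_chart (E := E) x₀ (mem_extChartAt_source x₀)
        rw [rderiv, hd.mfderiv, writtenInExtChartAt, coe_extChartAt_self]
        have h2 : id ∘ (extChartAt 𝓘(ℝ, E) x₀) ∘ (extChartAt 𝓘(ℝ, E) x₀).symm =ᶠ[
            𝓝 (extChartAt 𝓘(ℝ, E) x₀ x₀)] id := by
          filter_upwards [extChartAt_target_mem_nhds (I := 𝓘(ℝ, E)) x₀] with e he
          exact PartialEquiv.right_inv _ he
        simp only [modelWithCornersSelf_coe, Set.range_id, fderivWithin_univ]
        exact h2.fderiv_eq.trans fderiv_id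
      rw [h1]
      rfl
    have h2 := hpull x₀ (mem_extChartAt_source x₀) v
    rw [hid] at h2
    rw [← h2]
    exact hx₀ v hv
  have hev : ∀ᶠ e in 𝓝 (extChartAt 𝓘(ℝ, E) x₀ x₀), ∀ v ∈ Metric.sphere (0 : E) 1,
      0 < α.inChart x₀ e ![v, Complex.I • v] := by
    refine (isCompact_sphere (0 : E) 1).eventually_forall_of_forall_eventually fun v hv => ?_
    have hv0 : v ≠ 0 := by
      rintro rfl
      simp at hv
    have hc : ContinuousAt (fun z : E × E => α.inChart x₀ z.1 ![z.2, Complex.I • z.2])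
        (extChartAt 𝓘(ℝ, E) x₀ x₀, v) := by
      have h1 : ContinuousAt (fun z : E × E => α.inChart x₀ z.1)
          (extChartAt 𝓘(ℝ, E) x₀ x₀, v) := ContinuousAt.comp (f := Prod.fst) (g := α.inChart x₀)
        hcont continuousAt_fst
      have h2 : ContinuousAt (fun z : E × E => (![z.2, Complex.I • z.2] : Fin 2 → E))
          (extChartAt 𝓘(ℝ, E) x₀ x₀, v) := by
        refine Continuous.continuousAt (continuous_pi fun i => ?_)
        fin_cases i
        · exact continuous_snd
        · exact continuous_snd.const_smul Complex.I
      exact h1.eval h2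
    exact hc.eventually (lt_mem_nhds (hpos0 v hv0))
  filter_upwards [(continuousAt_extChartAt (I := 𝓘(ℝ, E)) x₀).eventually hev,
    extChartAt_source_mem_nhds (I := 𝓘(ℝ, E)) x₀] with x hx hs
  intro v hv
  rw [hpull x hs v]
  set w := rderiv E E (extChartAt 𝓘(ℝ, E) x₀) x v
  have hw0 : w ≠ 0 := fun h => hv (rderiv_chart_injective x₀ hs h)
  have hn : 0 < ‖w‖ := norm_pos_iff.2 hw0
  have h1 := hx (‖w‖⁻¹ • w) (by simp [norm_smul, hn.ne'])
  have h2 : (![‖w‖⁻¹ • w, Complex.I • ‖w‖⁻¹ • w] : Fin 2 → E) =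
      fun i => (fun _ : Fin 2 => ‖w‖⁻¹) i • (![w, Complex.I • w] : Fin 2 → E) i := by
    funext i
    fin_cases i
    · rfl
    · exact smul_comm _ _ _
  rw [h2, ContinuousAlternatingMap.map_smul_univ] at h1
  simp only [Fin.prod_univ_two, smul_eq_mul] at h1
  exact pos_of_mul_pos_right h1 (by positivity)

end Positive

/-! ### The Hermitian form on the total space -/

section TotalForm

variable {n : ℕ} {E F : Type*} [NormedAddCommGroup E] [NormedSpace ℂ E]
  [NormedAddCommGroup F] [NormedSpace ℂ F] {X Y : Type*}
  [TopologicalSpace X] [ChartedSpace E X] [TopologicalSpace Y] [ChartedSpace F Y]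

/-- The form `p^* σ + dd^c (∑ φ_j² / 2)`. -/
def totalForm (p : X → Y) (φ : Fin n → X → ℝ) (σ : DiffForm F Y 2) : DiffForm E X 2 :=
  DiffForm.pullback p σ + ddc fun x => ∑ j, φ j x ^ 2 / 2

/-- The moment map `ξ ↦ - ∑ ξ_j φ_j`. -/
def logMoment {X : Type*} (φ : Fin n → X → ℝ) (x : X) : StrongDual ℝ (Fin n → ℝ) :=
  -∑ j, φ j x • ContinuousLinearMap.proj (R := ℝ) (φ := fun _ : Fin n => ℝ) j

lemma logMoment_apply {X : Type*} (φ : Fin n → X → ℝ) (x : X) (ξ : Fin n → ℝ) :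
    logMoment φ x ξ = -∑ j, φ j x * ξ j := by
  simp [logMoment]

lemma logMoment_eq_zero_iff {X : Type*} (φ : Fin n → X → ℝ) (x : X) :
    logMoment φ x = 0 ↔ ∀ j, φ j x = 0 := by
  refine ⟨fun h j => ?_, fun h => by simp [logMoment, h]⟩
  have h1 := logMoment_apply φ x (Pi.single j 1)
  rw [h] at h1
  simpa [Pi.single_apply] using h1

variable [MulAction (ComplexTorus n) X] {p : X → Y} {φ : Fin n → X → ℝ} {σ : DiffForm F Y 2}

section Moment

variable (hφ : IsLogNorm E φ)
include hφ

lemma IsLogNorm.contMDiff_potential :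
    ContMDiff 𝓘(ℝ, E) 𝓘(ℝ, ℝ) ∞ (fun x => ∑ j, φ j x ^ 2 / 2) := by
  have h0 : ContDiff ℝ ∞ (fun w : Fin n → ℝ => ∑ j, w j ^ 2 / 2) := by fun_prop
  exact fun x => h0.contMDiff.contMDiffAt.comp x (contMDiffAt_pi_space.2 fun j => hφ.smooth j x)

lemma IsLogNorm.contMDiff_logMoment :
    ContMDiff 𝓘(ℝ, E) 𝓘(ℝ, StrongDual ℝ (Fin n → ℝ)) ∞ (logMoment φ) := by
  have h0 : ContDiff ℝ ∞ (fun w : Fin n → ℝ =>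
      -∑ j, w j • ContinuousLinearMap.proj (R := ℝ) (φ := fun _ : Fin n => ℝ) j) := by
    refine (ContDiff.sum fun j _ => ?_).neg
    exact (contDiff_apply ℝ ℝ j).smul contDiff_const
  exact fun x => h0.contMDiff.contMDiffAt.comp x (contMDiffAt_pi_space.2 fun j => hφ.smooth j x)

lemma IsLogNorm.rderiv_logMoment (x : X) (v : E) :
    rderiv E (StrongDual ℝ (Fin n → ℝ)) (logMoment φ) x v =
      -∑ j, rderiv E ℝ (φ j) x v • ContinuousLinearMap.proj (R := ℝ) (φ := fun _ : Fin n => ℝ) j := by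
  let B : (Fin n → ℝ) →L[ℝ] StrongDual ℝ (Fin n → ℝ) :=
    -∑ j, (ContinuousLinearMap.proj (R := ℝ) (φ := fun _ : Fin n => ℝ) j).smulRight
      (ContinuousLinearMap.proj (R := ℝ) (φ := fun _ : Fin n => ℝ) j)
  have hΦ : MDifferentiableAt 𝓘(ℝ, E) 𝓘(ℝ, Fin n → ℝ) (fun x j => φ j x) x :=
    (contMDiffAt_pi_space.2 fun j => hφ.smooth j x).mdifferentiableAt (by simp)
  have h1 : logMoment φ = B ∘ fun x j => φ j x := by
    funext x
    simp [logMoment, B]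
  have h2 : ∀ j, rderiv E (Fin n → ℝ) (fun x j => φ j x) x v j = rderiv E ℝ (φ j) x v := by
    intro j
    have h3 := rderiv_comp_model
      (ContinuousLinearMap.proj (R := ℝ) (φ := fun _ : Fin n => ℝ) j).differentiableAt hΦ
    rw [ContinuousLinearMap.fderiv] at h3
    exact (DFunLike.congr_fun h3 v).symm
  rw [h1, rderiv_comp_model B.differentiableAt hΦ, ContinuousLinearMap.fderiv]
  simp [B, h2]

lemma IsLogNorm.rderiv_logMoment_eq_zero_iff (x : X) (v : E) :
    rderiv E (StrongDual ℝ (Fin n → ℝ)) (logMoment φ) x v = 0 ↔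
      ∀ j, rderiv E ℝ (φ j) x v = 0 := by
  rw [hφ.rderiv_logMoment]
  -- The derivative has the same shape as `logMoment`, with the dφ_j as coefficients.
  exact logMoment_eq_zero_iff (X := E) (fun j v => rderiv E ℝ (φ j) x v) v

lemma IsLogNorm.rderiv_logMoment_apply (x : X) (v : E) (ξ : Fin n → ℝ) :
    rderiv E ℝ (fun y => logMoment φ y ξ) x v = -∑ j, rderiv E ℝ (φ j) x v * ξ j := by
  have hΨ := (hφ.contMDiff_logMoment.contMDiffAt (x := x)).mdifferentiableAt (by simp)
  have h1 := rderiv_comp_model (ContinuousLinearMap.apply ℝ ℝ ξ).differentiableAt hΨ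
  rw [ContinuousLinearMap.fderiv] at h1
  refine (DFunLike.congr_fun h1 v).trans ?_
  rw [ContinuousLinearMap.comp_apply, hφ.rderiv_logMoment]
  simp

end Moment

variable [IsManifold 𝓘(ℂ, E) ω X]
  (hp : IsAnalyticPrincipalBundle n (E := E) (F := F) p) (hφ : IsLogNorm E φ)

-- The Leibniz formula dd^c(φ²/2) = dφ ∧ d^cφ + φ dd^cφ; the pointwise computations with the form
-- start from it.
include hφ in
lemma totalForm_apply (x : X) (v u : E) :
    totalForm p φ σ x ![v, u] = σ (p x) ![rderiv E F p x v, rderiv E F p x u] +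
      ∑ j, (rderiv E ℝ (φ j) x u * rderiv E ℝ (φ j) x (Complex.I • v) -
        rderiv E ℝ (φ j) x v * rderiv E ℝ (φ j) x (Complex.I • u) +
        φ j x * (ddc (φ j) : DiffForm E X 2) x ![v, u]) := by
  rw [← ddc_sum_sq fun j => hφ.contMDiffAt j x, totalForm, Pi.add_apply,
    ContinuousAlternatingMap.add_apply]
  congr 1
  refine congrArg (σ (p x)) ?_
  funext i
  fin_cases i <;> rfl

include hp hφ

/-- Elements of K act holomorphically and preserve both `p` and the φ_j, so both summands are
natural under them. -/
lemma totalForm_invariant (k : CompactTorus n) (x : X) :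
    (totalForm p φ σ (CompactTorus.incl n k • x) : E [⋀^Fin 2]→L[ℝ] ℝ).compContinuousLinearMap
      (rderiv E E (fun y : X => CompactTorus.incl n k • y) x) = totalForm p φ σ x := by
  have hk := hp.contMDiff_smul (CompactTorus.incl n k)
  have hk' := mdifferentiableAt_real ((hk x).mdifferentiableAt (by simp))
  have hpd := mdifferentiableAt_real (hp.contMDiff.contMDiffAt.mdifferentiableAt
    (x := CompactTorus.incl n k • x) (by simp))
  have h1 : (DiffForm.pullback p σ : DiffForm E X 2) x =
      DiffForm.pullback (fun y : X => CompactTorus.incl n k • y)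
        (DiffForm.pullback p σ : DiffForm E X 2) x := by
    rw [← DiffForm.pullback_comp σ hpd hk']
    congr 1
    funext y
    exact (hp.invariant _ y).symm
  have h2 : (ddc (fun x => ∑ j, φ j x ^ 2 / 2) : DiffForm E X 2) x =
      DiffForm.pullback (fun y : X => CompactTorus.incl n k • y)
        (ddc (fun x => ∑ j, φ j x ^ 2 / 2) : DiffForm E X 2) x := by
    rw [← pullback_ddc hφ.contMDiff_potential.contMDiffAt (hk x)]
    congr 2
    funext y
    simp [hφ.incl_smul]
  rw [totalForm, Pi.add_apply, Pi.add_apply, h1, h2]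
  rfl

lemma totalForm_isContDiffAt [IsManifold 𝓘(ℂ, F) ω Y] (hσ : σ.SmoothOn Set.univ) (x : X) :
    (totalForm p φ σ : DiffForm E X 2).IsContDiffAt ∞ x := by
  have : IsManifold 𝓘(ℝ, E) ∞ X := isManifold_real
  have : IsManifold 𝓘(ℝ, F) ∞ Y := isManifold_real
  exact ((hσ.isContDiffAt (p x)).pullback le_rfl
    ((contMDiffAt_real hp.contMDiff.contMDiffAt).of_le le_top)).add
    (ddc_isContDiffAt hφ.contMDiff_potential.contMDiffAt)

lemma totalForm_I_smul (hσ : σ.HermitianOn Set.univ) (x : X) (v u : E) :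
    totalForm p φ σ x ![Complex.I • v, Complex.I • u] = totalForm p φ σ x ![v, u] := by
  have hd := hp.contMDiff.contMDiffAt.mdifferentiableAt (x := x) (by simp)
  have hI : ∀ w : E, Complex.I • Complex.I • w = -w := fun w => by
    rw [smul_smul, Complex.I_mul_I, neg_one_smul]
  rw [totalForm_apply hφ, totalForm_apply hφ, rderiv_I_smul hd, rderiv_I_smul hd,
    (hσ (p x) (Set.mem_univ _)).1]
  congr 1
  refine Finset.sum_congr rfl fun j _ => ?_
  rw [ddc_I_smul (hφ.contMDiffAt j x), hI, hI, map_neg, map_neg]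
  ring

/-- Since ξ_X is vertical, the pullback of σ and every dd^cφ_j drop out. Of dφ_j ∧ d^cφ_j only
dφ_j(v) dφ_j(J ξ_X) = -ξ_j dφ_j(v) survives. -/
lemma totalForm_fundamentalField [IsManifold 𝓘(ℂ, F) ω Y] (ξ : Fin n → ℝ) (x : X)
    (v : E) :
    totalForm p φ σ x ![fundamentalField E ξ x, v] = rderiv E ℝ (fun y => logMoment φ y ξ) x v := by
  obtain ⟨U, hU, hx, ⟨T⟩⟩ := hp.exists_holTriv (p x)
  have h0 : rderiv E F p x (fundamentalField E ξ x) = 0 := rderiv_p_fundamentalField hp ξ x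
  have hz : ∀ (α : F [⋀^Fin 2]→L[ℝ] ℝ) (u : F), α ![0, u] = 0 := fun α u =>
    α.map_coord_zero 0 rfl
  rw [totalForm_apply hφ, h0, hz, hφ.rderiv_logMoment_apply, ← Finset.sum_neg_distrib, zero_add]
  refine Finset.sum_congr rfl fun j _ => ?_
  have h1 : (ddc (φ j) : DiffForm E X 2) x ![fundamentalField E ξ x, v] = 0 := by
    rw [hφ.ddc_eq T hp.invariant hU hp.continuous hx j]
    refine Eq.trans ?_ (hz ((ddc fun y => φ j (T.S (1, y)) : DiffForm F Y 2) (p x))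
      (rderiv E F p x v))
    refine congrArg ((ddc fun y => φ j (T.S (1, y)) : DiffForm F Y 2) (p x)) ?_
    funext i
    fin_cases i
    · exact h0
    · rfl
  rw [h1, hφ.rderiv_fundamentalField hp, hφ.rderiv_I_fundamentalField hp]
  ring

/-- Where all φ_j vanish the curvature terms, of unknown sign, are absent. Horizontal directions are
then controlled by σ and vertical ones by the squares of the dφ_j. -/
lemma totalForm_pos (hσ : σ.HermitianOn Set.univ) {x : X} (hx : ∀ j, φ j x = 0) {v : E}
    (hv : v ≠ 0) : 0 < totalForm p φ σ x ![v, Complex.I • v] := by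
  obtain ⟨U, hU, hxU, ⟨T⟩⟩ := hp.exists_holTriv (p x)
  have hI : Complex.I • Complex.I • v = -v := by rw [smul_smul, Complex.I_mul_I, neg_one_smul]
  have hd := T.mdifferentiableAt_p hxU
  rw [totalForm_apply hφ, rderiv_I_smul hd, hI]
  have h1 : ∀ j, rderiv E ℝ (φ j) x (Complex.I • v) * rderiv E ℝ (φ j) x (Complex.I • v) -
      rderiv E ℝ (φ j) x v * rderiv E ℝ (φ j) x (-v) +
      φ j x * (ddc (φ j) : DiffForm E X 2) x ![v, Complex.I • v] =
      rderiv E ℝ (φ j) x (Complex.I • v) ^ 2 + rderiv E ℝ (φ j) x v ^ 2 := by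
    intro j
    rw [hx, map_neg]
    ring
  simp only [h1]
  by_cases h0 : rderiv E F p x v = 0
  · have hz : σ (p x) ![rderiv E F p x v, Complex.I • rderiv E F p x v] = 0 := by
      rw [h0]
      exact (σ (p x)).map_coord_zero 0 rfl
    rw [hz, zero_add]
    by_contra hneg
    have hsum : ∑ j, (rderiv E ℝ (φ j) x (Complex.I • v) ^ 2 + rderiv E ℝ (φ j) x v ^ 2) = 0 :=
      le_antisymm (not_lt.1 hneg) (Finset.sum_nonneg fun j _ => by positivity)
    rw [Finset.sum_eq_zero_iff_of_nonneg fun j _ => by positivity] at hsum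
    refine hv (hφ.rderiv_eq_zero_imp T hp.invariant hU hp.continuous hxU h0 (fun j => ?_)
      fun j => ?_)
    · nlinarith [hsum j (Finset.mem_univ j), sq_nonneg (rderiv E ℝ (φ j) x (Complex.I • v))]
    · nlinarith [hsum j (Finset.mem_univ j), sq_nonneg (rderiv E ℝ (φ j) x v)]
  · exact add_pos_of_pos_of_nonneg ((hσ (p x) (Set.mem_univ _)).2 _ h0)
      (Finset.sum_nonneg fun j _ => by positivity)

lemma totalForm_closed [IsManifold 𝓘(ℂ, F) ω Y] (hσ : σ.SmoothOn Set.univ) (hcl : σ.ClosedOn Set.univ) (x : X) :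
    (totalForm p φ σ : DiffForm E X 2).d x = 0 := by
  have : IsManifold 𝓘(ℝ, E) ∞ X := isManifold_real
  have : IsManifold 𝓘(ℝ, F) ∞ Y := isManifold_real
  have hp' : ContMDiffAt 𝓘(ℝ, E) 𝓘(ℝ, F) ∞ p x :=
    (contMDiffAt_real hp.contMDiff.contMDiffAt).of_le le_top
  have h1 : (DiffForm.pullback p σ : DiffForm E X 2).IsContDiffAt 1 x :=
    ((hσ.isContDiffAt (p x)).pullback le_rfl hp').of_le (by simp)
  have h2 : (ddc fun x => ∑ j, φ j x ^ 2 / 2 : DiffForm E X 2).IsContDiffAt 1 x :=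
    (ddc_isContDiffAt hφ.contMDiff_potential.contMDiffAt).of_le (by simp)
  rw [totalForm, DiffForm.d_add h1 h2,
    DiffForm.d_pullback ((hσ.isContDiffAt (p x)).of_le (by simp)) hp']
  rw [ddc, DiffForm.d_d (dc_isContDiffAt hφ.contMDiff_potential.contMDiffAt), add_zero]
  simp only [DiffForm.pullback, hcl (p x) (Set.mem_univ _)]
  rfl

/-- Invariance under k⁻¹ moves the question back to `x`, along a derivative that is injective and
complex linear. -/
lemma smul_mem_positiveSet (k : CompactTorus n) {x : X}
    (hx : x ∈ (totalForm p φ σ : DiffForm E X 2).positiveSet) :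
    CompactTorus.incl n k • x ∈ (totalForm p φ σ : DiffForm E X 2).positiveSet := by
  intro v hv
  have hk := hp.contMDiff_smul (CompactTorus.incl n k⁻¹)
  have hd := (hk (CompactTorus.incl n k • x)).mdifferentiableAt (by simp)
  have hdk := ((hp.contMDiff_smul (CompactTorus.incl n k)) x).mdifferentiableAt (by simp)
  have hinv : ∀ y : X, CompactTorus.incl n k⁻¹ • CompactTorus.incl n k • y = y := fun y => by
    rw [smul_smul, ← map_mul, inv_mul_cancel, map_one, one_smul]
  have hinv' : ∀ y : X, CompactTorus.incl n k • CompactTorus.incl n k⁻¹ • y = y := fun y => by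
    rw [smul_smul, ← map_mul, mul_inv_cancel, map_one, one_smul]
  set D := rderiv E E (fun y : X => CompactTorus.incl n k⁻¹ • y) (CompactTorus.incl n k • x)
  have h1 := totalForm_invariant (σ := σ) hp hφ k⁻¹ (CompactTorus.incl n k • x)
  rw [hinv] at h1
  have h2 : D v ≠ 0 := by
    intro h
    have h3 := rderiv_comp (x := CompactTorus.incl n k • x)
      (f := fun y : X => CompactTorus.incl n k⁻¹ • y)
      (g := fun y : X => CompactTorus.incl n k • y) (E := E) (F := E) (G := E)
      (by rw [hinv]; exact mdifferentiableAt_real hdk) (mdifferentiableAt_real hd)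
    have h4 : (fun y : X => CompactTorus.incl n k • y) ∘
        (fun y : X => CompactTorus.incl n k⁻¹ • y) = id := funext hinv'
    rw [h4, rderiv_id] at h3
    have h5 := DFunLike.congr_fun h3 v
    rw [ContinuousLinearMap.comp_apply] at h5
    change v = _ at h5
    refine hv (h5.trans ?_)
    change rderiv E E _ _ (D v) = 0
    rw [h, map_zero]
  have h6 := hx (D v) h2
  rw [← rderiv_I_smul hd] at h6
  rw [← h1]
  refine h6.trans_eq (congrArg (totalForm p φ σ x) ?_)
  funext i
  fin_cases i <;> rfl

end TotalForm

/-! ### Transport of a complex structure along a homeomorphism -/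

section Transport

variable {F : Type*} [NormedAddCommGroup F] [NormedSpace ℂ F]
  {R Y : Type*} [TopologicalSpace R] [TopologicalSpace Y] [ChartedSpace F Y]

/-- The charts of `Y`, transported along a homeomorphism `R ≃ₜ Y`. -/
abbrev transportedCharts (h : R ≃ₜ Y) : ChartedSpace F R where
  atlas := (fun e : OpenPartialHomeomorph Y F => h.toOpenPartialHomeomorph.trans e) '' atlas F Y
  chartAt r := h.toOpenPartialHomeomorph.trans (chartAt F (h r))
  mem_chart_source r := by simp
  chart_mem_atlas r := ⟨_, chart_mem_atlas F (h r), rfl⟩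

/-- The homeomorphism cancels in every transition map, leaving a transition map of `Y`. -/
lemma transportedCharts_isManifold [IsManifold 𝓘(ℂ, F) ω Y] (h : R ≃ₜ Y) :
    letI := transportedCharts (F := F) h
    IsManifold 𝓘(ℂ, F) ω R := by
  let := transportedCharts (F := F) h
  refine isManifold_of_contDiffOn _ _ _ ?_
  rintro _ _ ⟨e, he, rfl⟩ ⟨e', he', rfl⟩
  have h1 := StructureGroupoid.compatible (contDiffGroupoid ω 𝓘(ℂ, F)) he he'
  rw [contDiffGroupoid, mem_groupoid_of_pregroupoid] at h1
  refine (h1.1 : ContDiffOn ℂ ω _ _).congr_mono (fun x hx => ?_) fun x hx => ?_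
  · simp
  · simpa using hx

/-- In the transported charts the homeomorphism reads as the identity. -/
lemma contMDiff_transport (h : R ≃ₜ Y) :
    letI := transportedCharts (F := F) h
    ContMDiff 𝓘(ℂ, F) 𝓘(ℂ, F) ω h := by
  let := transportedCharts (F := F) h
  intro r
  rw [contMDiffAt_iff]
  refine ⟨h.continuous.continuousAt, ?_⟩
  refine contDiffWithinAt_id.congr_of_eventuallyEq_of_mem ?_ (Set.mem_range_self _)
  have h1 : (extChartAt 𝓘(ℂ, F) (h r)).target ∈ 𝓝 (extChartAt 𝓘(ℂ, F) r r) :=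
    extChartAt_target_mem_nhds (I := 𝓘(ℂ, F)) (h r)
  filter_upwards [mem_nhdsWithin_of_mem_nhds h1] with e he
  have h2 : extChartAt 𝓘(ℂ, F) (h r) (h (h.symm ((extChartAt 𝓘(ℂ, F) (h r)).symm e))) = e := by
    rw [h.apply_symm_apply]
    exact PartialEquiv.right_inv _ he
  exact h2

lemma contMDiff_transport_symm (h : R ≃ₜ Y) :
    letI := transportedCharts (F := F) h
    ContMDiff 𝓘(ℂ, F) 𝓘(ℂ, F) ω h.symm := by
  let := transportedCharts (F := F) h
  intro y
  obtain ⟨r, rfl⟩ := h.surjective y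
  rw [contMDiffAt_iff]
  refine ⟨h.symm.continuous.continuousAt, ?_⟩
  rw [h.symm_apply_apply]
  refine contDiffWithinAt_id.congr_of_eventuallyEq_of_mem ?_ (Set.mem_range_self _)
  have h1 : (extChartAt 𝓘(ℂ, F) (h r)).target ∈ 𝓝 (extChartAt 𝓘(ℂ, F) (h r) (h r)) :=
    extChartAt_target_mem_nhds (I := 𝓘(ℂ, F)) (h r)
  filter_upwards [mem_nhdsWithin_of_mem_nhds h1] with e he
  have h2 : extChartAt 𝓘(ℂ, F) (h r) (h (h.symm ((extChartAt 𝓘(ℂ, F) (h r)).symm e))) = e := by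
    rw [h.apply_symm_apply]
    exact PartialEquiv.right_inv _ he
  exact h2

end Transport

/-! ### The reduction space -/

section Reduction

variable {n : ℕ} {E F : Type*} [NormedAddCommGroup E] [NormedSpace ℂ E]
  [NormedAddCommGroup F] [NormedSpace ℂ F] {X Y : Type*}
  [TopologicalSpace X] [ChartedSpace E X] [TopologicalSpace Y] [ChartedSpace F Y]
  [MulAction (ComplexTorus n) X] {p : X → Y} {φ : Fin n → X → ℝ} {V : Set X}

lemma CompactTorus.incl_injective : Function.Injective (CompactTorus.incl n) := by
  intro k l h
  funext j
  exact Circle.ext (congrArg Units.val (congrFun h j))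

lemma CompactTorus.exists_incl_eq (g : ComplexTorus n) (hg : ∀ j, ‖(g j : ℂ)‖ = 1) :
    ∃ k : CompactTorus n, CompactTorus.incl n k = g :=
  ⟨fun j => ⟨g j, by simpa [Submonoid.unitSphere] using hg j⟩, funext fun j => Units.ext rfl⟩

lemma rderiv_logMoment_surjective (hp : IsAnalyticPrincipalBundle n (E := E) (F := F) p)
    (hφ : IsLogNorm E φ) (x : X) :
    Function.Surjective (rderiv E (StrongDual ℝ (Fin n → ℝ)) (logMoment φ) x) := by
  intro l
  obtain ⟨U, hU, hx, ⟨T⟩⟩ := hp.exists_holTriv (p x)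
  -- The dφ_j can be prescribed independently; the sign compensates the one in `logMoment`.
  obtain ⟨v, -, hv⟩ := hφ.exists_rderiv_eq T hp.invariant hU hp.continuous hx 0
    fun j => -l (Pi.single j 1)
  refine ⟨v, (hφ.rderiv_logMoment x v).trans ?_⟩
  ext ξ
  have h1 : (-∑ j, rderiv E ℝ (φ j) x v •
      ContinuousLinearMap.proj (R := ℝ) (φ := fun _ : Fin n => ℝ) j) ξ =
      ∑ j, l (Pi.single j 1) * ξ j := by
    simp [hv]
  refine h1.trans ?_
  conv_rhs => rw [← Finset.univ_sum_single ξ, map_sum]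
  refine Finset.sum_congr rfl fun j _ => ?_
  have : (Pi.single j (ξ j) : Fin n → ℝ) = ξ j • Pi.single j 1 := by
    rw [← Pi.single_smul, smul_eq_mul, mul_one]
  rw [this, map_smul, smul_eq_mul, mul_comm]

/-- The projection of the bundle, on the reduction space. -/
def reductionMap (hpi : ∀ (g : ComplexTorus n) (x : X), p (g • x) = p x)
    (Ψ : X → StrongDual ℝ (Fin n → ℝ)) (V : Set X) : ReductionSpace Ψ V → Y :=
  Quotient.lift (fun x : zeroLevel Ψ V => p x) fun a b ⟨k, hk⟩ => by
    rw [← hk, hpi]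

variable (hp : IsAnalyticPrincipalBundle n (E := E) (F := F) p) (hφ : IsLogNorm E φ)
  (hV : ∀ x, (∀ j, φ j x = 0) → x ∈ V)
include hp hφ

/-- Points of one fibre differ by some g. If all φ_j vanish at both, then log |g_j| = 0, so g lies
in K. -/
lemma reductionMap_injective :
    Function.Injective (reductionMap hp.invariant (logMoment φ) V) := by
  rintro ⟨a⟩ ⟨b⟩ hab
  have hab' : p a = p b := hab
  obtain ⟨g, hg⟩ := hp.exists_smul_eq hab'
  have ha := (logMoment_eq_zero_iff φ a).1 a.2.2
  have hb := (logMoment_eq_zero_iff φ b).1 b.2.2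
  have h1 : ∀ j, ‖(g j : ℂ)‖ = 1 := by
    intro j
    have h2 := hφ.smul g a j
    rw [hg, ha, hb, zero_add] at h2
    exact Real.eq_one_of_pos_of_log_eq_zero (by simp) h2.symm
  obtain ⟨k, rfl⟩ := CompactTorus.exists_incl_eq g h1
  exact Quotient.sound ⟨k, hg⟩

include hV

/-- Rescaling the unit section by exp(-φ_j) lands in the zero level. This gives both surjectivity of
the reduction map and continuity of its inverse. -/
lemma exists_local_section (y₀ : Y) : ∃ U : Set Y, IsOpen U ∧ y₀ ∈ U ∧
    ∃ s : U → zeroLevel (logMoment φ) V, Continuous s ∧ ∀ y, p (s y) = y := by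
  obtain ⟨U, hU, hy, ⟨T⟩⟩ := hp.exists_holTriv y₀
  let w : Y → Fin n → ℂ := fun y j => (Real.exp (-φ j (T.S (1, y))) : ℂ)
  have hw : ∀ y j, w y j ≠ 0 := fun y j => by
    simp [w]
  have hp' : ∀ y ∈ U, p (T.S (w y, y)) = y := fun y hy => T.p_S _ (hw y) y hy
  have hzero : ∀ y ∈ U, ∀ j, φ j (T.S (w y, y)) = 0 := by
    intro y hy j
    have h1 : T.S (w y, y) ∈ p ⁻¹' U := by
      rw [Set.mem_preimage, hp' y hy]
      exact hy
    rw [hφ.eq_log_add T hp.invariant h1, hp' y hy, T.z_S _ (hw y) y hy]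
    simp only [w, Complex.norm_real, Real.norm_eq_abs, Real.abs_exp, Real.log_exp, add_neg_cancel]
  refine ⟨U, hU, hy, fun y => ⟨T.S (w y, y), hV _ (hzero y y.2),
    (logMoment_eq_zero_iff φ _).2 (hzero y y.2)⟩, ?_, fun y => hp' y y.2⟩
  refine Continuous.subtype_mk (continuous_iff_continuousAt.2 fun y => ?_) _
  have h1 : ContinuousAt (fun y => T.S (1, y)) (y : Y) :=
    (T.contMDiffAt_S_right (w := 1) (by simp) y.2).continuousAt
  have h2 : ContinuousAt w (y : Y) := by
    refine continuousAt_pi.2 fun j => ?_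
    have h3 : ContinuousAt (fun y => φ j (T.S (1, y))) (y : Y) :=
      ContinuousAt.comp (g := φ j) (hφ.smooth j).continuous.continuousAt h1
    exact Complex.continuous_ofReal.continuousAt.comp (Real.continuous_exp.continuousAt.comp h3.neg)
  have h4 : ContinuousAt (fun y => T.S (w y, y)) (y : Y) :=
    ContinuousAt.comp (g := T.S) (T.S_smooth _ (hw y) y y.2).continuousAt (h2.prodMk continuousAt_id)
  exact h4.comp continuousAt_subtype_val

lemma reductionMap_surjective :
    Function.Surjective (reductionMap hp.invariant (logMoment φ) V) := by
  intro y
  obtain ⟨U, hU, hy, s, -, hs⟩ := exists_local_section hp hφ hV y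
  exact ⟨ReductionSpace.proj _ _ (s ⟨y, hy⟩), hs ⟨y, hy⟩⟩

/-- The reduction space is homeomorphic to the base of the bundle. -/
def reductionHomeo : ReductionSpace (logMoment φ) V ≃ₜ Y where
  toEquiv := Equiv.ofBijective (reductionMap hp.invariant (logMoment φ) V)
    ⟨reductionMap_injective hp hφ, reductionMap_surjective hp hφ hV⟩
  continuous_toFun := Continuous.quotient_lift (hp.continuous.comp continuous_subtype_val) _
  continuous_invFun := by
    refine continuous_iff_continuousAt.2 fun y₀ => ?_
    obtain ⟨U, hU, hy, s, hc, hs⟩ := exists_local_section hp hφ hV y₀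
    refine ContinuousOn.continuousAt ?_ (hU.mem_nhds hy)
    rw [continuousOn_iff_continuous_domRestrict]
    have h1 : Continuous fun y => ReductionSpace.proj (logMoment φ) V (s y) :=
      continuous_quotient_mk'.comp hc
    refine h1.congr fun y => ?_
    exact ((Equiv.symm_apply_eq (Equiv.ofBijective (reductionMap hp.invariant (logMoment φ) V)
      ⟨reductionMap_injective hp hφ, reductionMap_surjective hp hφ hV⟩)).2 (hs y).symm).symm

end Reduction

/-! ### The presentation of the base as a reduction -/

section Main

variable {n : ℕ} {E F : Type*} [NormedAddCommGroup E] [NormedSpace ℂ E] [FiniteDimensional ℂ E]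
  [NormedAddCommGroup F] [NormedSpace ℂ F] {X Y : Type*}
  [TopologicalSpace X] [ChartedSpace E X] [TopologicalSpace Y] [ChartedSpace F Y]
  [MulAction (ComplexTorus n) X] [IsManifold 𝓘(ℂ, E) ω X] [IsManifold 𝓘(ℂ, F) ω Y]
  {p : X → Y} {φ : Fin n → X → ℝ} {σ : DiffForm F Y 2}
  (hp : IsAnalyticPrincipalBundle n (E := E) (F := F) p) (hφ : IsLogNorm E φ)
  (hσ : σ.SmoothOn Set.univ) (hσ' : σ.HermitianOn Set.univ)
include hp hφ hσ hσ'

-- The charts of `Y` are transported along `h`, which makes `h` biholomorphic at once, and τ is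
-- `h^*σ`. The content is that this is the structure which reduction prescribes.
omit [FiniteDimensional ℂ E] in
lemma exists_reductionStructure :
    ∃ (_ : ChartedSpace F (ReductionSpace (logMoment φ)
        (totalForm p φ σ : DiffForm E X 2).positiveSet))
      (τ : DiffForm F (ReductionSpace (logMoment φ)
        (totalForm p φ σ : DiffForm E X 2).positiveSet) 2),
      IsReductionStructure (totalForm p φ σ : DiffForm E X 2) (logMoment φ)
        (totalForm p φ σ : DiffForm E X 2).positiveSet τ ∧
      Nonempty (Diffeomorph 𝓘(ℂ, F) 𝓘(ℂ, F) (ReductionSpace (logMoment φ)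
        (totalForm p φ σ : DiffForm E X 2).positiveSet) Y ω) := by
  set V := (totalForm p φ σ : DiffForm E X 2).positiveSet
  have hV : ∀ x, (∀ j, φ j x = 0) → x ∈ V := fun x hx v hv => totalForm_pos hp hφ hσ' hx hv
  let h := reductionHomeo hp hφ hV
  let := transportedCharts (F := F) h
  have hmR : IsManifold 𝓘(ℂ, F) ω (ReductionSpace (logMoment φ) V) := transportedCharts_isManifold h
  have hh : ContMDiff 𝓘(ℂ, F) 𝓘(ℂ, F) ω h := contMDiff_transport h
  have hh' : ContMDiff 𝓘(ℂ, F) 𝓘(ℂ, F) ω h.symm := contMDiff_transport_symm h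
  have : IsManifold 𝓘(ℝ, F) ∞ Y := isManifold_real
  have : IsManifold 𝓘(ℝ, F) ∞ (ReductionSpace (logMoment φ) V) := isManifold_real
  have hd : ∀ r, MDifferentiableAt 𝓘(ℂ, F) 𝓘(ℂ, F) h r := fun r =>
    (hh r).mdifferentiableAt (by simp)
  have hd' : ∀ y, MDifferentiableAt 𝓘(ℂ, F) 𝓘(ℂ, F) h.symm y := fun y =>
    (hh' y).mdifferentiableAt (by simp)
  have hhinj : ∀ r (v : F), rderiv F F h r v = 0 → v = 0 := by
    intro r v hv
    have h1 := rderiv_comp (x := r) (mdifferentiableAt_real (hd' (h r)))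
      (mdifferentiableAt_real (hd r))
    have h2 : h.symm ∘ h = id := funext h.symm_apply_apply
    rw [h2, rderiv_id] at h1
    have h3 := DFunLike.congr_fun h1 v
    rw [ContinuousLinearMap.comp_apply, hv, map_zero] at h3
    exact h3
  have hpullσ : ∀ r (v u : F), (DiffForm.pullback h σ : DiffForm F _ 2) r ![v, u] =
      σ (h r) ![rderiv F F h r v, rderiv F F h r u] := by
    intro r v u
    refine congrArg (σ (h r)) ?_
    funext i
    fin_cases i <;> rfl
  refine ⟨inferInstance, DiffForm.pullback h σ, ?_, ⟨{
    toEquiv := h.toEquiv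
    contMDiff_toFun := hh
    contMDiff_invFun := hh' }⟩⟩
  refine ⟨hmR, fun x _ => ?_, fun x _ k hk => ?_, ?_, fun r _ => ⟨fun v u => ?_, fun v hv => ?_⟩,
    fun x => ?_⟩
  · exact rderiv_logMoment_surjective hp hφ x
  · exact CompactTorus.incl_injective (by rw [hp.smul_eq_self hk, map_one])
  · exact DiffForm.smoothOn_of_isContDiffAt fun r _ => (hσ.isContDiffAt (h r)).pullback le_rfl
      ((contMDiffAt_real (hh r)).of_le le_top)
  · rw [hpullσ, hpullσ, rderiv_I_smul (hd r), rderiv_I_smul (hd r)]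
    exact (hσ' (h r) (Set.mem_univ _)).1 _ _
  · rw [hpullσ, rderiv_I_smul (hd r)]
    exact (hσ' (h r) (Set.mem_univ _)).2 _ fun h0 => hv (hhinj r v h0)
  · have hq : ContMDiff 𝓘(ℂ, E) 𝓘(ℂ, F) ω (h.symm ∘ p) := hh'.comp hp.contMDiff
    have hqd : MDifferentiableAt 𝓘(ℂ, E) 𝓘(ℂ, F) (h.symm ∘ p) (x : X) :=
      (hq x).mdifferentiableAt (by simp)
    have hqx : (h.symm ∘ p) (x : X) = ReductionSpace.proj (logMoment φ) V x := by
      rw [Function.comp, Homeomorph.symm_apply_eq]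
      rfl
    have hDp : ∀ v, rderiv F F h (ReductionSpace.proj (logMoment φ) V x)
        (rderiv E F (h.symm ∘ p) x v) = rderiv E F p x v := by
      intro v
      have h1 := rderiv_comp (x := (x : X)) (f := h.symm ∘ p) (g := h)
        (mdifferentiableAt_real (hd _)) (mdifferentiableAt_real hqd)
      have h2 : h ∘ h.symm ∘ p = p := funext fun x => h.apply_symm_apply (p x)
      rw [h2, hqx] at h1
      exact (DFunLike.congr_fun h1 v).symm
    have hT : ∀ v : E, v ∈ LinearMap.ker (rderiv E (StrongDual ℝ (Fin n → ℝ)) (logMoment φ)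
        (x : X)).toLinearMap ↔ ∀ j, rderiv E ℝ (φ j) x v = 0 := fun v =>
      LinearMap.mem_ker.trans (hφ.rderiv_logMoment_eq_zero_iff x v)
    have hx0 := (logMoment_eq_zero_iff φ (x : X)).1 x.2.2
    -- The projection extends from the level to the holomorphic map h⁻¹ ∘ p on all of `X`, so its
    -- derivative is complex linear everywhere.
    refine ⟨Set.univ, h.symm ∘ p, isOpen_univ, Set.mem_univ _, fun y _ =>
      ((contMDiffAt_real (hq y)).of_le le_top).contMDiffWithinAt, fun y _ => ?_,
      LinearMap.ker (rderiv E (StrongDual ℝ (Fin n → ℝ)) (logMoment φ) (x : X)).toLinearMap,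
      rderiv E F (h.symm ∘ p) x, rfl, rfl, fun z => ?_, fun v _ _ => rderiv_I_smul hqd v,
      fun v hv u hu => ?_⟩
    · rw [Function.comp, Homeomorph.symm_apply_eq]
      rfl
    · obtain ⟨U, hU, hx, ⟨T⟩⟩ := hp.exists_holTriv (p x)
      -- The lift is taken with all dφ_j(v) = 0, so that it is tangent to the level.
      obtain ⟨v, hv, hv0⟩ := hφ.exists_rderiv_eq T hp.invariant hU hp.continuous hx
        (rderiv F F h (ReductionSpace.proj (logMoment φ) V x) z) fun _ => 0
      refine ⟨v, (hT v).2 hv0, ?_⟩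
      refine sub_eq_zero.1 (hhinj (ReductionSpace.proj (logMoment φ) V x) _ ?_)
      rw [map_sub, hDp, hv, sub_self]
    · rw [hT] at hv hu
      rw [hpullσ, hDp, hDp, totalForm_apply hφ]
      -- On tangent vectors of the level the dφ_j vanish, and so do the φ_j themselves; only the
      -- pullback of σ remains.
      simp only [hv, hu, hx0, zero_mul, sub_self, add_zero, Finset.sum_const_zero]
      rfl

lemma presentsAsReduction : PresentsAsReduction F Y (totalForm p φ σ : DiffForm E X 2)
    (logMoment φ) (totalForm p φ σ : DiffForm E X 2).positiveSet := by
  have : IsManifold 𝓘(ℝ, E) ∞ X := isManifold_real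
  have hopen : IsOpen (totalForm p φ σ : DiffForm E X 2).positiveSet :=
    DiffForm.isOpen_positiveSet (totalForm_isContDiffAt hp hφ hσ)
  have hξ : ∀ ξ : Fin n → ℝ, ContMDiff 𝓘(ℝ, E) 𝓘(ℝ, ℝ) ∞ fun x => logMoment φ x ξ := fun ξ x =>
    (ContinuousLinearMap.apply ℝ ℝ ξ).contDiff.contMDiff.contMDiffAt.comp x
      (hφ.contMDiff_logMoment x)
  refine ⟨hopen, fun k x hx => smul_mem_positiveSet hp hφ k hx,
    DiffForm.smoothOn_of_isContDiffAt fun x _ => totalForm_isContDiffAt hp hφ hσ x,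
    fun x hx v hv => ?_, fun x hx => ⟨totalForm_I_smul hp hφ hσ' x, hx⟩,
    ⟨fun k x _ => totalForm_invariant hp hφ k x, fun ξ x _ => ?_⟩,
    ⟨hφ.contMDiff_logMoment.contMDiffOn, fun k x _ => ?_, fun ξ x _ v =>
      (totalForm_fundamentalField hp hφ ξ x v).symm⟩, exists_reductionStructure hp hφ hσ hσ'⟩
  -- Test against u = Jv.
  · by_contra h0
    exact (hx v h0).ne' (hv _)
  -- The contraction is exact on all of `X`, with primitive Ψ^ξ, whether or not σ is closed.
  · have h1 : DiffForm.contract (fundamentalField E ξ) (totalForm p φ σ : DiffForm E X 2) =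
        (zeroForm fun y => logMoment φ y ξ).d := by
      funext y
      rw [zeroForm_d ((hξ ξ y).mdifferentiableAt (by simp))]
      ext v
      have h2 := totalForm_fundamentalField (σ := σ) hp hφ ξ y (v 0)
      refine Eq.trans ?_ h2
      refine congrArg (totalForm p φ σ y) ?_
      funext i
      fin_cases i <;> rfl
    rw [h1]
    exact DiffForm.d_d (zeroForm_isContDiffAt (hξ ξ x))
  · simp only [logMoment, hφ.incl_smul]

end Main

end MomentReduction

end

/-! ### The theorem, from an arbitrary Hermitian or a Kähler form on the base -/

theorem mainTheorem3 (n : ℕ)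
    {E : Type*} [NormedAddCommGroup E] [NormedSpace ℂ E] [FiniteDimensional ℂ E]
    {F : Type*} [NormedAddCommGroup F] [NormedSpace ℂ F] [FiniteDimensional ℂ F]
    {X : Type*} [TopologicalSpace X] [T2Space X] [SecondCountableTopology X]
    [ChartedSpace E X] [IsManifold 𝓘(ℂ, E) ω X]
    {Y : Type*} [TopologicalSpace Y] [T2Space Y] [SecondCountableTopology Y]
    [ChartedSpace F Y] [IsManifold 𝓘(ℂ, F) ω Y]
    [MulAction (MomentReduction.ComplexTorus n) X] [ProperSMul (MomentReduction.ComplexTorus n) X]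
    (p : X → Y) (hp : MomentReduction.IsAnalyticPrincipalBundle n (E := E) (F := F) p) :
    (∃ (V : Set X) (Ω : MomentReduction.DiffForm E X 2) (Ψ : X → StrongDual ℝ (Fin n → ℝ)),
      MomentReduction.PresentsAsReduction F Y Ω Ψ V) ∧
    (MomentReduction.IsKahlerManifold F Y →
      ∃ (V : Set X) (Ω : MomentReduction.DiffForm E X 2) (Ψ : X → StrongDual ℝ (Fin n → ℝ)),
        MomentReduction.PresentsAsReduction F Y Ω Ψ V ∧ Ω.KahlerOn V) := by
  obtain ⟨φ, hφ⟩ := hp.exists_isLogNorm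
  constructor
  · obtain ⟨σ, hσ, hσ'⟩ := MomentReduction.exists_hermitian (F := F) (Y := Y)
    exact ⟨_, _, _, MomentReduction.presentsAsReduction hp hφ hσ hσ'⟩
  · rintro ⟨σ, hσ⟩
    have h := MomentReduction.presentsAsReduction hp hφ hσ.smooth hσ.hermitian
    exact ⟨_, _, _, h, h.smooth, h.hermitian, fun x _ =>
      MomentReduction.totalForm_closed hp hφ hσ.smooth hσ.closed x⟩
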